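/- Let $\mathbb{R}^{3,1}$ be Minkowski $4$-space with the form $\langle\cdot,\cdot\rangle$ of signature $(-+++)$, let $\mathfrak p=(1,0,0,1)$, and let isotropic $3$-space be $\mathbb{I}^3=\{X:\langle X,\mathfrak p\rangle=0\}$, with coordinates $(l,x,y)\leftrightarrow(l,x,y,l)$ and induced degenerate metric $dx^2+dy^2$. Its isometries are the compositions of translations and of restrictions of those linear isometries of $\mathbb{R}^{3,1}$, of either orientation, that fix $\mathfrak p$; its homotheties are $P\mapsto rP$ with $r>0$. Let $\Sigma\subset\mathbb{R}^2\cong\mathbb{C}$ be open and simply connected, and let $X:\Sigma\to\mathbb{I}^3$ be a smooth spacelike immersion (the induced metric is positive definite; the parameters need not be conformal). Suppose that $X$ has zero mean curvature, where the second fundamental form is $\langle X_{ij},n\rangle$ with $n$ the lightlike Gauss map, determined by $\langle n,n\rangle=0$, $\langle dX,n\rangle=0$, $\langle n,\mathfrak p\rangle=1$. Suppose also that $X$ is affine minimal: with $\tilde L,\tilde M,\tilde N$ the determinants $\det(X_u,X_v,\cdot)$ at $X_{uu},X_{uv},X_{vv}$, the affine (Blaschke) mean curvature $\frac12\operatorname{tr}\tilde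 S$, where $d\tilde n=-dX\circ\tilde S$ for the affine normal $\tilde n$, vanishes at all points with $\tilde L\tilde N-\tilde M^2\neq0$ (no condition is imposed at the other points, so that planes are admitted). For functions $h,\eta$, the surface with Weierstrass data $(h,\eta\,dz)$ is $Y=\operatorname{Re}\int(h,1,-i)\,\eta\,dz$, in the coordinates $(l,x,y)$, on $\{z\in\mathbb{C}:\eta(z)\neq0\}$. Call $X$ a piece of this surface up to isometries and homotheties if $X=T\circ Y\circ\varphi$ on $\Sigma$ for a composition $T$ of an isometry and a homothety and a smooth local diffeomorphism $\varphi$ from $\Sigma$ into $\{\eta\ne0\}$. Then, up to isometries and homotheties, $X$ is a piece of a surface of one, and only one, of the following five kinds: 1. the plane, $(0,\,dz)$; 2. the trivial Enneper-type surface, $(z,\,i\,dz)$; 3. the helicoid, $(e^{z},\,ie^{-z}\,dz)$; 4. the Enneper-type surface, $(\frac1z,\,iz^2\,dz)$; 5. one of the Thomsen-type surfaces, $\left(\frac{\alpha}{\beta}\coth\frac{\alpha z}{2},\; i\,\frac{2\beta}{\alpha^2}\sinh^2\frac{\alpha z}{2}\,dz\right)$ with $\alpha,\beta>0$. In the last case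 the ratio $\alpha/\beta$ is uniquely determined by $X$. -/

import Mathlib

open scoped ContDiff

noncomputable section

namespace Isotropic

/-! ### Minkowski `4`-space and isotropic `3`-space -/

/-- The underlying vector space of Minkowski `4`-space. -/
abbrev Minkowski := Fin 4 → ℝ

/-- The bilinear form of signature `(- + + +)`. -/
def mink (X Y : Minkowski) : ℝ := -(X 0 * Y 0) + X 1 * Y 1 + X 2 * Y 2 + X 3 * Y 3

/-- The fixed light-like vector `𝔭 = (1, 0, 0, 1)`. -/
def pVec : Minkowski := ![1, 0, 0, 1]

/-- Isotropic `3`-space, in the coordinates `(l, x, y)`; the `l`-direction is vertical. -/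
abbrev I3 := Fin 3 → ℝ

/-- The identification of the coordinate space with `{X | ⟨X, 𝔭⟩ = 0}`,
`(l, x, y) ↦ (l, x, y, l)`. -/
def toMink (P : I3) : Minkowski := ![P 0, P 1, P 2, P 0]

/-- An isometry of isotropic `3`-space: the composition of a translation along isotropic space
and the restriction of a linear isometry of Minkowski space which fixes `𝔭`
(either orientation is allowed). -/
def IsIsometry (T : I3 → I3) : Prop :=
  ∃ (A : Minkowski →ₗ[ℝ] Minkowski) (t : I3),
    (∀ X Y, mink (A X) (A Y) = mink X Y) ∧ A pVec = pVec ∧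
      ∀ P, toMink (T P) = A (toMink P) + toMink t

/-- A composition of a homothety `P ↦ r P`, `r > 0`, and an isometry. -/
def IsSimilarity (T : I3 → I3) : Prop :=
  ∃ (r : ℝ) (S : I3 → I3), 0 < r ∧ IsIsometry S ∧ ∀ P, T P = S (r • P)

/-! ### Surfaces

A parametrized surface is a map `X : ℂ → I3` considered on an open set `U`; the parameter is
`u + i v`, and `ℂ` serves only as the real plane here: no conformality is assumed. -/

/-- The partial derivative `∂/∂u`. -/
def du {F : Type*} [NormedAddCommGroup F] [NormedSpace ℝ F] (f : ℂ → F) (q : ℂ) : F :=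
  fderiv ℝ f q 1

/-- The partial derivative `∂/∂v`. -/
def dv {F : Type*} [NormedAddCommGroup F] [NormedSpace ℝ F] (f : ℂ → F) (q : ℂ) : F :=
  fderiv ℝ f q Complex.I

/-- `X` is a smooth spacelike immersion on `U`: the induced metric is positive definite. -/
def IsSpacelikeImmersion (U : Set ℂ) (X : ℂ → I3) : Prop :=
  ContDiffOn ℝ ∞ X U ∧
    ∀ q ∈ U, ∀ w : ℂ, w ≠ 0 →
      0 < mink (toMink (fderiv ℝ X q w)) (toMink (fderiv ℝ X q w))

/-- `n` is the value at `q` of the lightlike Gauss map of `X`. -/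
def IsLightlikeNormal (X : ℂ → I3) (q : ℂ) (n : Minkowski) : Prop :=
  mink n n = 0 ∧ (∀ w : ℂ, mink (toMink (fderiv ℝ X q w)) n = 0) ∧ mink n pVec = 1

/-- The mean curvature of `X` at `q` with respect to `n`: half the trace of the second
fundamental form `L du² + 2 M du dv + N dv²` with respect to the first fundamental form
`E du² + 2 F du dv + G dv²`. -/
def meanCurvature (X : ℂ → I3) (q : ℂ) (n : Minkowski) : ℝ :=
  let E := mink (toMink (du X q)) (toMink (du X q))
  let F := mink (toMink (du X q)) (toMink (dv X q))
  let G := mink (toMink (dv X q)) (toMink (dv X q))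
  let L := mink (toMink (du (du X) q)) n
  let M := mink (toMink (du (dv X) q)) n
  let N := mink (toMink (dv (dv X) q)) n
  (E * N - 2 * F * M + G * L) / (2 * (E * G - F ^ 2))

/-- The mean curvature of `X` vanishes on `U`
(a spacelike immersion has exactly one lightlike Gauss map). -/
def HasZeroMeanCurvature (U : Set ℂ) (X : ℂ → I3) : Prop :=
  ∃ n : ℂ → Minkowski, ∀ q ∈ U, IsLightlikeNormal X q (n q) ∧ meanCurvature X q (n q) = 0

/-! ### Affine differential geometry of surfaces -/

/-- The determinant of three vectors. -/
def det3 (a b c : I3) : ℝ := Matrix.det (Matrix.of ![a, b, c])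

/-- `L̃ Ñ - M̃²`, where `L̃, M̃, Ñ` are the determinants `det (X_u, X_v, ·)` at
`X_uu, X_uv, X_vv`. -/
def affineDisc (X : ℂ → I3) (q : ℂ) : ℝ :=
  det3 (du X q) (dv X q) (du (du X) q) * det3 (du X q) (dv X q) (dv (dv X) q)
    - det3 (du X q) (dv X q) (du (dv X) q) ^ 2

/-- The points of `U` at which the surface is non-degenerate. -/
def nondegenerateSet (U : Set ℂ) (X : ℂ → I3) : Set ℂ := {q ∈ U | affineDisc X q ≠ 0}

/-- `S` is the affine shape operator at `q` belonging to the transversal field `ξ`: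
`dξ = - dX ∘ S`. -/
def IsAffineShape (X ξ : ℂ → I3) (q : ℂ) (S : ℂ →ₗ[ℝ] ℂ) : Prop :=
  ∀ w : ℂ, fderiv ℝ ξ q w = - fderiv ℝ X q (S w)

/-- `ξ` is an affine (Blaschke) normal field of `X` on the open set `V`, which is to consist of
non-degenerate points: `ξ` is smooth, its derivative is tangential, and the volume
`det (X_u, X_v, ξ)` is up to sign the area density of the affine fundamental form of `ξ`,
whose coefficients are `L̃ / D, M̃ / D, Ñ / D` with `D = det (X_u, X_v, ξ)`; that is,
`D² = |L̃ Ñ - M̃²| / D²`. Such a field exists on the set of all non-degenerate points and is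
unique up to sign on each component; it is half the Laplacian of `X` with respect to the
Berwald-Blaschke metric. In asymptotic coordinates which are conformal for a
metric `e^{2ω} (du² + dv²)` it is `± e^{-ω} X_uv`. -/
def IsAffineNormal (V : Set ℂ) (X ξ : ℂ → I3) : Prop :=
  ContDiffOn ℝ ∞ ξ V ∧ ∀ q ∈ V,
    det3 (du X q) (dv X q) (ξ q) ^ 4 = |affineDisc X q| ∧
      ∃ S : ℂ →ₗ[ℝ] ℂ, IsAffineShape X ξ q S

/-- The affine mean curvature, half the trace of the affine shape operator, vanishes at every
non-degenerate point of the surface. -/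
def IsAffineMinimal (U : Set ℂ) (X : ℂ → I3) : Prop :=
  ∃ ξ : ℂ → I3, IsAffineNormal (nondegenerateSet U X) X ξ ∧
    ∀ q ∈ nondegenerateSet U X, ∀ S : ℂ →ₗ[ℝ] ℂ, IsAffineShape X ξ q S →
      1 / 2 * LinearMap.trace ℝ ℂ S = 0

/-! ### Weierstrass data -/

/-- Weierstrass data `(h, η dz)` on the complex plane. -/
structure WData where
  h : ℂ → ℂ
  η : ℂ → ℂ

/-- The set where the Weierstrass data define an immersion (the induced metric is
`|η|² |dz|²`). The poles of `h` are among the zeros of `η` in all data below. -/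
def WData.regularSet (D : WData) : Set ℂ := {z | D.η z ≠ 0}

/-- `Y = Re ∫ (h, 1, -i) η dz` on the regular set. -/
def WData.IsSurface (D : WData) (Y : ℂ → I3) : Prop :=
  ∃ Φ : Fin 3 → ℂ → ℂ, ∀ z ∈ D.regularSet,
    HasDerivAt (Φ 0) (D.h z * D.η z) z ∧
    HasDerivAt (Φ 1) (D.η z) z ∧
    HasDerivAt (Φ 2) (-Complex.I * D.η z) z ∧
    ∀ k, Y z k = (Φ k z).re

/-- Up to isometries and homotheties, `X` on `U` is a piece of the surface with data `D`:
it is a reparametrization of a similar copy of a part of it. -/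
def IsPieceOf (U : Set ℂ) (X : ℂ → I3) (D : WData) : Prop :=
  ∃ (Y : ℂ → I3) (T : I3 → I3) (φ : ℂ → ℂ),
    D.IsSurface Y ∧ IsSimilarity T ∧ ContDiffOn ℝ ∞ φ U ∧
      ∀ q ∈ U, φ q ∈ D.regularSet ∧ Function.Bijective (fderiv ℝ φ q) ∧ X q = T (Y (φ q))

/-- The data `(0, dz)`. -/
def planeData : WData := ⟨fun _ => 0, fun _ => 1⟩

/-- The data `(z, i dz)`. -/
def trivialEnneperData : WData := ⟨fun z => z, fun _ => Complex.I⟩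

/-- The data `(e^z, i e^{-z} dz)`. -/
def helicoidData : WData := ⟨fun z => Complex.exp z, fun z => Complex.I * Complex.exp (-z)⟩

/-- The data `(1/z, i z² dz)`. -/
def enneperData : WData := ⟨fun z => 1 / z, fun z => Complex.I * z ^ 2⟩

/-- The data `((α/β) coth (α z / 2), i (2 β / α²) sinh² (α z / 2) dz)`. -/
def thomsenData (α β : ℝ) : WData :=
  ⟨fun z => (α / β : ℂ) * (Complex.cosh (α * z / 2) / Complex.sinh (α * z / 2)),
   fun z => Complex.I * (2 * β / α ^ 2 : ℂ) * Complex.sinh (α * z / 2) ^ 2⟩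

/-- The five kinds of surfaces. -/
inductive Kind where
  | plane
  | trivialEnneper
  | helicoid
  | enneper
  | thomsen

/-- The Weierstrass data of the surfaces of each kind. -/
def Kind.data : Kind → Set WData
  | .plane => {planeData}
  | .trivialEnneper => {trivialEnneperData}
  | .helicoid => {helicoidData}
  | .enneper => {enneperData}
  | .thomsen => {D | ∃ α β : ℝ, 0 < α ∧ 0 < β ∧ D = thomsenData α β}

end Isotropic

end

namespace Isotropic

open Complex Set Filter Topology ComplexConjugate

/-! In the complex coordinate `ζ = x + iy`, which is a local coordinate because the metric is
`|dζ|²`, a surface has zero mean curvature exactly when its height is locally the real part of a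
holomorphic function. Hence `dl = Re (g dζ)` and `dg = P dζ` with `g`, `P` holomorphic in `ζ`
(`exists_surfaceData`). The affine fundamental form is a multiple of `Re (P dζ²)`, so the
non-degenerate points are those with `P ≠ 0`.

Where `P = p²`, affine minimality says that `K = 2 p p_gg - p_g²` has vanishing real part, the
subscripts being derivatives with respect to `g` (`re_schwarzian_eq_zero`). Being holomorphic, `K`
is then constant, and `dK/dg = 2 p p_ggg` makes `p` a polynomial of degree at most two in `g` whose
discriminant `-K` is imaginary (`exists_quadratic`). By the identity theorem `P = (a g² + b g + c)²`
on the whole surface, and uniqueness for the resulting ODE excludes zeros of `P` unless `P` vanishes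
identically.

The cases `P = 0`, nonzero constant, linear, double root and two distinct roots give the five kinds.
An isometry acts on `g` by `g ↦ u g + v` with `|u| = 1`, possibly after conjugation; a reflection
fixes the sign of the discriminant. Integrating `dg = P dζ` yields the parameter `z`, and the
logarithms that occur are single valued since the domain is simply connected.

Conversely, on each model `P` is a multiple of a real polynomial in an affine function of `g`
(`SurfaceData.hasProfile`). Vanishing of `P`, the degree and the roots distinguish the kinds. Half
the distance of the two roots is `α/β` in the Thomsen case, and it survives the substitutions `g ↦ u
g + v`. -/

theorem eq_zero_of_forall_re_mul_eq_zero {a : ℂ} (h : ∀ w : ℂ, (a * w).re = 0) : a = 0 := by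
  have h1 := h 1
  have h2 := h I
  apply Complex.ext <;> simp_all

/-! ### The affine minimality equation in an isothermal parameter -/

/-- On an open set where it has vanishing real part, a holomorphic function has vanishing
derivative. -/
theorem deriv_eq_zero_of_re_eq_zero {B : Set ℂ} (hB : IsOpen B) {f : ℂ → ℂ}
    (hf : DifferentiableOn ℂ f B) (hre : ∀ z ∈ B, (f z).re = 0) {z : ℂ} (hz : z ∈ B) :
    deriv f z = 0 := by
  have hd : HasDerivAt f (deriv f z) z := (hf.differentiableAt (hB.mem_nhds hz)).hasDerivAt
  have h1 := reCLM.hasFDerivAt.comp z (hd.hasFDerivAt.restrictScalars ℝ)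
  have h2 : HasFDerivAt (reCLM ∘ f) (0 : ℂ →L[ℝ] ℝ) z :=
    (hasFDerivAt_const (0 : ℝ) z).congr_of_eventuallyEq <| by
      filter_upwards [hB.mem_nhds hz] with y hy using hre y hy
  have h3 := h1.unique h2
  refine eq_zero_of_forall_re_mul_eq_zero fun w => ?_
  have := congrArg (fun L => L w) h3
  simpa [mul_comm] using this

/-- The vanishing of the affine mean curvature in an isothermal parameter. Here `p ^ 2` is the
second derivative of the height, `τ` the vertical and `ξ` the horizontal component of the affine
normal field. -/
theorem re_schwarzian_eq_zero {B : Set ℂ} (hB : IsOpen B) {p : ℂ → ℂ}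
    (hp : DifferentiableOn ℂ p B) (hp0 : ∀ z ∈ B, p z ≠ 0) {τ : ℂ → ℝ}
    (hτ : ∀ z ∈ B, τ z ^ 4 = ‖p z‖ ^ 4) {ξ : ℂ → ℂ} (hξ : DifferentiableOn ℝ ξ B)
    (hdτ : ∀ z ∈ B, ∃ τ' : ℂ →L[ℝ] ℝ, HasFDerivAt τ τ' z ∧ ∀ w, τ' w = -(ξ z * p z ^ 2 * w).re)
    (htr : ∀ z ∈ B, (fderiv ℝ ξ z 1).re + (fderiv ℝ ξ z I).im = 0) {z : ℂ} (hz : z ∈ B) :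
    (2 * deriv (deriv p) z / p z ^ 3 - 5 * deriv p z ^ 2 / p z ^ 4).re = 0 := by
  have hτ2 : ∀ z ∈ B, τ z ^ 2 = normSq (p z) := fun z hz => by
    rw [normSq_eq_norm_sq]
    have := hτ z hz
    have h : (τ z ^ 2) ^ 2 = (‖p z‖ ^ 2) ^ 2 := by linear_combination this
    exact (pow_left_inj₀ (by positivity) (by positivity) two_ne_zero).1 h
  have hpd : ∀ z ∈ B, HasDerivAt p (deriv p z) z := fun z hz =>
    (hp.differentiableAt (hB.mem_nhds hz)).hasDerivAt
  have hpR : ∀ z ∈ B, HasFDerivAt p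
      ((ContinuousLinearMap.toSpanSingleton ℂ (deriv p z)).restrictScalars ℝ) z :=
    fun z hz => (hpd z hz).hasFDerivAt.restrictScalars ℝ
  have hpdd : HasDerivAt (deriv p) (deriv (deriv p) z) z :=
    ((hp.deriv hB).differentiableAt (hB.mem_nhds hz)).hasDerivAt
  -- This is the differential of `τ² = p · conj p`, with `dτ = -Re (ξ p² dz)` inserted.
  have key : ∀ z ∈ B, (τ z : ℂ) * ξ z = -(conj (p z) * (deriv p z / p z ^ 2)) := by
    intro z hz
    obtain ⟨τ', h1, h2⟩ := hdτ z hz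
    have h3 : HasFDerivAt (fun y => (p y).re * (p y).re + (p y).im * (p y).im) _ z :=
      ((reCLM.hasFDerivAt.comp z (hpR z hz)).mul (reCLM.hasFDerivAt.comp z (hpR z hz))).add
        ((imCLM.hasFDerivAt.comp z (hpR z hz)).mul (imCLM.hasFDerivAt.comp z (hpR z hz)))
    have h4 : HasFDerivAt (fun y => (p y).re * (p y).re + (p y).im * (p y).im) _ z :=
      (h1.mul h1).congr_of_eventuallyEq <| by
        filter_upwards [hB.mem_nhds hz] with y hy
        have := hτ2 y hy
        rw [normSq_apply] at this
        simp only [Pi.mul_apply]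
        linarith
    have h5 := h3.unique h4
    have h6 : (τ z : ℂ) * ξ z * p z ^ 2 + conj (p z) * deriv p z = 0 := by
      refine eq_zero_of_forall_re_mul_eq_zero fun w => ?_
      have := congrArg (fun L => L w) h5
      simp [h2, pow_two] at this
      simp [pow_two]
      linarith
    have := hp0 z hz
    field_simp
    linear_combination h6
  obtain ⟨τ', h1, h2⟩ := hdτ z hz
  have hξd := (hξ.differentiableAt (hB.mem_nhds hz)).hasFDerivAt
  have h0 := hp0 z hz
  have hfd : HasDerivAt (fun y => deriv p y / p y ^ 2)
      ((deriv (deriv p) z * p z ^ 2 - deriv p z * (2 * p z * deriv p z)) / (p z ^ 2) ^ 2) z := by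
    have := hpdd.div ((hpd z hz).pow 2) (pow_ne_zero 2 h0)
    convert! this using 1
    simp
  set f' := (deriv (deriv p) z * p z ^ 2 - deriv p z * (2 * p z * deriv p z)) / (p z ^ 2) ^ 2
    with hf'
  have h3 : HasFDerivAt (fun y => (τ y : ℂ) * ξ y) _ z := (ofRealCLM.hasFDerivAt.comp z h1).mul hξd
  have h4 : HasFDerivAt (fun y => (τ y : ℂ) * ξ y) _ z :=
    ((((conjCLE : ℂ →L[ℝ] ℂ).hasFDerivAt.comp z (hpR z hz)).mul
      (hfd.hasFDerivAt.restrictScalars ℝ)).neg).congr_of_eventuallyEq <| by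
        filter_upwards [hB.mem_nhds hz] with y hy
        simpa using key y hy
  have h5 := h3.unique h4
  have e1 := congrArg (fun L => (L 1).re) h5
  have e2 := congrArg (fun L => (L I).im) h5
  have e3 := htr z hz
  simp [h2] at e1 e2
  have hk := key z hz
  have hτ0 : (τ z : ℂ) ^ 2 = conj (p z) * p z := by
    rw [← normSq_eq_conj_mul_self]; exact_mod_cast hτ2 z hz
  -- Both sides of `key` are differentiated and their divergences compared. Since `div ξ = 0`, the
  -- left side gives `dτ(ξ) = -Re (ξ² p²)`; the right side is `-conj p` times a holomorphic function
  -- with derivative `f'`, and gives `-2 Re (conj p · f')`.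
  have e4 : (ξ z ^ 2 * p z ^ 2 - 2 * (conj (p z) * f')).re = 0 := by
    simp [pow_two] at e1 e2 ⊢
    linear_combination (-1) * e1 - e2 + τ z * e3
  have hc0 : conj (p z) ≠ 0 := by simpa using h0
  have e5 : ξ z ^ 2 * p z ^ 2 - 2 * (conj (p z) * f')
      = -(normSq (p z) : ℂ) * (2 * deriv (deriv p) z / p z ^ 3 - 5 * deriv p z ^ 2 / p z ^ 4) := by
    have e6 : ξ z ^ 2 * p z = conj (p z) * (deriv p z / p z ^ 2) ^ 2 := by
      apply mul_left_cancel₀ hc0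
      calc conj (p z) * (ξ z ^ 2 * p z) = (τ z * ξ z) ^ 2 := by rw [mul_pow, hτ0]; ring
        _ = _ := by rw [hk]; ring
    rw [normSq_eq_conj_mul_self, hf',
      show ξ z ^ 2 * p z ^ 2 = (ξ z ^ 2 * p z) * p z by ring, e6]
    field_simp
    ring
  rw [e5, ← ofReal_neg, re_ofReal_mul] at e4
  exact (mul_eq_zero.1 e4).resolve_left (by simpa using h0)

/-- If `G' = p ^ 2` and the affine mean curvature vanishes, `p` is a quadratic polynomial in `G`
with imaginary discriminant. -/
theorem exists_quadratic {B : Set ℂ} (hB : IsOpen B) (hBc : IsPreconnected B) (hne : B.Nonempty)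
    {p G : ℂ → ℂ} (hp : DifferentiableOn ℂ p B) (hp0 : ∀ z ∈ B, p z ≠ 0)
    (hG : ∀ z ∈ B, HasDerivAt G (p z ^ 2) z)
    (hre : ∀ z ∈ B, (2 * deriv (deriv p) z / p z ^ 3 - 5 * deriv p z ^ 2 / p z ^ 4).re = 0) :
    ∃ a b c : ℂ, (b ^ 2 - 4 * a * c).re = 0 ∧ ∀ z ∈ B, p z = a * G z ^ 2 + b * G z + c := by
  have const : ∀ f : ℂ → ℂ, (∀ z ∈ B, HasDerivAt f 0 z) → ∃ a, ∀ z ∈ B, f z = a := by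
    intro f hf
    refine hB.exists_is_const_of_fderiv_eq_zero (𝕜 := ℂ) hBc
      (fun z hz => (hf z hz).differentiableAt.differentiableWithinAt) fun z hz => ?_
    simpa using (hf z hz).hasFDerivAt.fderiv
  have hd1 : DifferentiableOn ℂ (deriv p) B := hp.deriv hB
  have hpd : ∀ z ∈ B, HasDerivAt p (deriv p z) z := fun z hz =>
    (hp.differentiableAt (hB.mem_nhds hz)).hasDerivAt
  have hpdd : ∀ z ∈ B, HasDerivAt (deriv p) (deriv (deriv p) z) z := fun z hz =>
    (hd1.differentiableAt (hB.mem_nhds hz)).hasDerivAt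
  -- `f1` and `f2` are the first and second derivatives of `p` with respect to `G`, because `dG = p²
  -- dz`.
  set f1 : ℂ → ℂ := fun z => deriv p z / p z ^ 2 with hf1
  set f2 : ℂ → ℂ := fun z => deriv (deriv p) z / p z ^ 4 - 2 * deriv p z ^ 2 / p z ^ 5 with hf2
  have hf1d : ∀ z ∈ B, HasDerivAt f1 (f2 z * p z ^ 2) z := by
    intro z hz
    have h0 := hp0 z hz
    have := (hpdd z hz).div ((hpd z hz).pow 2) (pow_ne_zero 2 h0)
    convert! this using 1
    simp [hf2]
    field_simp
  have hf2d : DifferentiableOn ℂ f2 B :=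
    ((hd1.deriv hB).div (hp.pow 4) fun z hz => pow_ne_zero 4 (hp0 z hz)).sub
      (((differentiableOn_const _).mul (hd1.pow 2)).div (hp.pow 5)
        fun z hz => pow_ne_zero 5 (hp0 z hz))
  have hf2d' : ∀ z ∈ B, HasDerivAt f2 (deriv f2 z) z := fun z hz =>
    (hf2d.differentiableAt (hB.mem_nhds hz)).hasDerivAt
  -- In the variable `G` this is `2 p p_GG - p_G²`, minus the discriminant when `p` is quadratic. In
  -- its derivative the terms with `p_G p_GG` cancel and only the third derivative of `p` remains.
  set K : ℂ → ℂ := fun z => 2 * p z * f2 z - f1 z ^ 2 with hK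
  have hKd : ∀ z ∈ B, HasDerivAt K (2 * p z * deriv f2 z) z := by
    intro z hz
    have h0 := hp0 z hz
    have := (((hpd z hz).const_mul 2).mul (hf2d' z hz)).sub ((hf1d z hz).pow 2)
    convert! this using 1
    simp [hf1]
    field_simp
    ring
  have hKre : ∀ z ∈ B, (K z).re = 0 := by
    intro z hz
    have h0 := hp0 z hz
    rw [← hre z hz]
    congr 1
    simp only [hK, hf1, hf2]
    field_simp
    ring
  have hf2z : ∀ z ∈ B, HasDerivAt f2 0 z := by
    intro z hz
    have h1 := deriv_eq_zero_of_re_eq_zero hB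
      (fun z hz => (hKd z hz).differentiableAt.differentiableWithinAt) hKre hz
    rw [(hKd z hz).deriv] at h1
    have := hf2d' z hz
    rwa [(mul_eq_zero.1 h1).resolve_left (mul_ne_zero two_ne_zero (hp0 z hz))] at this
  obtain ⟨a, ha⟩ := const f2 hf2z
  obtain ⟨b, hb⟩ := const (fun z => f1 z - a * G z) fun z hz => by
    have := (hf1d z hz).sub ((hG z hz).const_mul a)
    convert! this using 1
    rw [ha z hz]; ring
  obtain ⟨c, hc⟩ := const (fun z => p z - (a / 2 * G z ^ 2 + b * G z)) fun z hz => by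
    have := (hpd z hz).sub ((((hG z hz).pow 2).const_mul (a / 2)).add ((hG z hz).const_mul b))
    convert! this using 1
    have h1 : deriv p z = f1 z * p z ^ 2 := by
      have h0 := hp0 z hz
      simp only [hf1]; field_simp
    rw [h1, ← hb z hz]
    simp
    ring
  refine ⟨a / 2, b, c, ?_, fun z hz => by rw [← hc z hz]; ring⟩
  obtain ⟨z, hz⟩ := hne
  have h1 : b ^ 2 - 4 * (a / 2) * c = -K z := by
    simp only [hK]
    rw [ha z hz, ← hc z hz, ← hb z hz]
    ring
  rw [h1]; simp [hKre z hz]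

/-! ### Null coordinates on isotropic space -/

/-- The projection of isotropic space to the complex plane along the isotropic direction. -/
noncomputable def horL : I3 →L[ℝ] ℂ :=
  ((ContinuousLinearMap.proj 1 : I3 →L[ℝ] ℝ).smulRight (1 : ℂ)) +
    ((ContinuousLinearMap.proj 2 : I3 →L[ℝ] ℝ).smulRight I)

@[simp] theorem horL_re (a : I3) : (horL a).re = a 1 := by simp [horL]
@[simp] theorem horL_im (a : I3) : (horL a).im = a 2 := by simp [horL]

/-- The height function on isotropic space. -/
noncomputable def verL : I3 →L[ℝ] ℝ := ContinuousLinearMap.proj 0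

@[simp] theorem verL_apply (a : I3) : verL a = a 0 := rfl

theorem ext_horL {a b : I3} (h0 : a 0 = b 0) (h : horL a = horL b) : a = b := by
  have h1 := congrArg re h
  have h2 := congrArg im h
  simp only [horL_re, horL_im] at h1 h2
  ext i
  fin_cases i <;> assumption

theorem mink_toMink (a b : I3) : mink (toMink a) (toMink b) = a 1 * b 1 + a 2 * b 2 := by
  simp [mink, toMink]
  ring

/-- Subtracting from `c` the vector of the plane `l = Re (g ζ)` above the same `ζ` leaves a vertical
vector: the determinant is horizontal area times height over the tangent plane. -/
theorem det3_eq {a b c : I3} {g : ℂ} (ha : a 0 = (g * horL a).re) (hb : b 0 = (g * horL b).re) :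
    det3 a b c = (a 1 * b 2 - a 2 * b 1) * (c 0 - (g * horL c).re) := by
  simp only [mul_re, horL_re, horL_im] at *
  simp [det3, Matrix.det_fin_three]
  rw [ha, hb]
  ring

/-- The data of a surface with zero mean curvature: with the complex coordinate `ζ = x + i y`, the
height `l` satisfies `dl = Re (g dζ)` for a function `g` with `dg = P dζ`. -/
structure SurfaceData (U : Set ℂ) (X : ℂ → I3) (g P : ℂ → ℂ) : Prop where
  smooth : ContDiffOn ℝ ∞ X U
  smooth_g : ContDiffOn ℝ ∞ g U
  bij : ∀ q ∈ U, Function.Bijective fun w => horL (fderiv ℝ X q w)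
  dl : ∀ q ∈ U, ∀ w, fderiv ℝ X q w 0 = (g q * horL (fderiv ℝ X q w)).re
  dg : ∀ q ∈ U, ∀ w, fderiv ℝ g q w = P q * horL (fderiv ℝ X q w)

theorem contDiffOn_fderiv_apply {E : Type*} [NormedAddCommGroup E] [NormedSpace ℝ E] {U : Set ℂ}
    (hU : IsOpen U) {f : ℂ → E} (hf : ContDiffOn ℝ ∞ f U) (e : ℂ) :
    ContDiffOn ℝ ∞ (fun q => fderiv ℝ f q e) U :=
  (hf.fderiv_of_isOpen hU (by simp)).clm_apply contDiffOn_const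

theorem differentiableAt_of_contDiffOn {E : Type*} [NormedAddCommGroup E] [NormedSpace ℝ E]
    {U : Set ℂ} (hU : IsOpen U) {f : ℂ → E} (hf : ContDiffOn ℝ ∞ f U) {q : ℂ} (hq : q ∈ U) :
    DifferentiableAt ℝ f q :=
  (hf.contDiffAt (hU.mem_nhds hq)).differentiableAt (by simp)

theorem fderiv_fderiv_apply_comm {E : Type*} [NormedAddCommGroup E] [NormedSpace ℝ E] {U : Set ℂ}
    (hU : IsOpen U) {f : ℂ → E} (hf : ContDiffOn ℝ ∞ f U) {q : ℂ} (hq : q ∈ U) (e e' : ℂ) :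
    fderiv ℝ (fun p => fderiv ℝ f p e) q e' = fderiv ℝ (fun p => fderiv ℝ f p e') q e := by
  have hd : DifferentiableAt ℝ (fderiv ℝ f) q :=
    differentiableAt_of_contDiffOn hU (hf.fderiv_of_isOpen hU (by simp)) hq
  have h : ∀ e, fderiv ℝ (fun p => fderiv ℝ f p e) q = (fderiv ℝ (fderiv ℝ f) q).flip e := by
    intro e
    rw [fderiv_clm_apply hd (differentiableAt_const e)]
    ext; simp
  have hs : IsSymmSndFDerivAt ℝ f q :=
    (hf.contDiffAt (hU.mem_nhds hq)).isSymmSndFDerivAt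
      (by simpa using WithTop.coe_le_coe.2 (le_top : (2 : ℕ∞) ≤ ⊤))
  rw [h, h]
  simpa using hs e' e

/-- Differentiation of `dl = Re (g dζ)`. -/
theorem snd_height {U : Set ℂ} (hU : IsOpen U) {X : ℂ → I3} (hX : ContDiffOn ℝ ∞ X U) {g : ℂ → ℂ}
    (hg : ContDiffOn ℝ ∞ g U)
    (dl : ∀ q ∈ U, ∀ w, fderiv ℝ X q w 0 = (g q * horL (fderiv ℝ X q w)).re) {q : ℂ} (hq : q ∈ U)
    (e e' : ℂ) :
    fderiv ℝ (fun p => fderiv ℝ X p e) q e' 0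
        - (g q * horL (fderiv ℝ (fun p => fderiv ℝ X p e) q e')).re
      = (fderiv ℝ g q e' * horL (fderiv ℝ X q e)).re := by
  have h1 : HasFDerivAt (fun p => fderiv ℝ X p e) (fderiv ℝ (fun p => fderiv ℝ X p e) q) q :=
    (differentiableAt_of_contDiffOn hU (contDiffOn_fderiv_apply hU hX e) hq).hasFDerivAt
  have h2 : HasFDerivAt g (fderiv ℝ g q) q :=
    (differentiableAt_of_contDiffOn hU hg hq).hasFDerivAt
  have h3 : HasFDerivAt (fun p => verL (fderiv ℝ X p e)) _ q := verL.hasFDerivAt.comp q h1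
  have h4 : HasFDerivAt (fun p => reCLM (g p * horL (fderiv ℝ X p e))) _ q :=
    reCLM.hasFDerivAt.comp q (h2.mul (horL.hasFDerivAt.comp q h1))
  have h5 := h3.unique (h4.congr_of_eventuallyEq (by
    filter_upwards [hU.mem_nhds hq] with p hp using dl p hp e))
  have := congrArg (fun L => L e') h5
  simp at this
  simp [this]
  ring

/-- The degenerate metric is the pull-back of `|dζ|²`, so positivity of the induced metric means
that `ζ` is an immersion. -/
theorem IsSpacelikeImmersion.bijective {U : Set ℂ} {X : ℂ → I3} (hX : IsSpacelikeImmersion U X)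
    {q : ℂ} (hq : q ∈ U) : Function.Bijective fun w => horL (fderiv ℝ X q w) := by
  have hinj : Function.Injective (horL ∘L fderiv ℝ X q : ℂ →ₗ[ℝ] ℂ) := by
    rw [injective_iff_map_eq_zero]
    intro w hw
    by_contra h
    have h1 := hX.2 q hq w h
    have h2 : horL (fderiv ℝ X q w) = 0 := hw
    have h3 := congrArg re h2
    have h4 := congrArg im h2
    simp only [horL_re, horL_im, zero_re, zero_im] at h3 h4
    rw [mink_toMink, h3, h4] at h1
    simp at h1
  exact ⟨hinj, LinearMap.injective_iff_surjective.1 hinj⟩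

/-- The area of the frame `1, i` with respect to a bijective linear map. -/
theorem area_ne_zero {L : ℂ →L[ℝ] ℂ} (hL : Function.Injective L) :
    (L 1).re * (L I).im - (L 1).im * (L I).re ≠ 0 := by
  intro h
  have key : ∀ r s : ℝ, r • L 1 + s • L I = 0 → r = 0 ∧ s = 0 := by
    intro r s hrs
    have h1 : L ⟨r, s⟩ = 0 := by
      have : (⟨r, s⟩ : ℂ) = r • 1 + s • I := by apply Complex.ext <;> simp
      rw [this, map_add, map_smul, map_smul, hrs]
    have h2 := (injective_iff_map_eq_zero L).1 hL _ h1
    exact ⟨congrArg re h2, congrArg im h2⟩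
  have h1 := key (L I).im (-(L 1).im) (by
    apply Complex.ext
    · simp; linarith
    · simp; ring)
  have h2 := key (L I).re (-(L 1).re) (by
    apply Complex.ext
    · simp; ring
    · simp; linarith)
  have h3 : L 1 = 0 := Complex.ext (by simpa using h2.2) (by simpa using h1.2)
  exact one_ne_zero ((injective_iff_map_eq_zero L).1 hL _ h3)

/-- Against the lightlike normal, the second fundamental form is `Re (dg dζ)`. Symmetry of the mixed
derivatives and vanishing of the trace are the two real equations saying that `dg` is a complex
multiple of `dζ`. -/
theorem exists_surfaceData {U : Set ℂ} (hU : IsOpen U) {X : ℂ → I3}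
    (hX : IsSpacelikeImmersion U X) (hH : HasZeroMeanCurvature U X) :
    ∃ g P, SurfaceData U X g P := by
  obtain ⟨n, hn⟩ := hH
  set J : ℂ → ℝ := fun q => du X q 1 * dv X q 2 - du X q 2 * dv X q 1 with hJ
  -- Cramer's rule for the two real equations `l_u = Re (g ζ_u)`, `l_v = Re (g ζ_v)`, with
  -- determinant `J` up to sign.
  set g : ℂ → ℂ := fun q => I * (du X q 0 * conj (horL (dv X q)) - dv X q 0 * conj (horL (du X q)))
    * ((J q)⁻¹ : ℝ) with hg
  have hJ0 : ∀ q ∈ U, J q ≠ 0 := fun q hq => by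
    simpa [hJ, du, dv] using area_ne_zero (L := horL ∘L fderiv ℝ X q) (hX.bijective hq).1
  have su : ContDiffOn ℝ ∞ (du X) U := contDiffOn_fderiv_apply hU hX.1 1
  have sv : ContDiffOn ℝ ∞ (dv X) U := contDiffOn_fderiv_apply hU hX.1 I
  have su' := contDiffOn_pi.1 su
  have sv' := contDiffOn_pi.1 sv
  have smg : ContDiffOn ℝ ∞ g U := by
    have hc : ∀ {f : ℂ → ℝ}, ContDiffOn ℝ ∞ f U → ContDiffOn ℝ ∞ (fun q => (f q : ℂ)) U :=
      fun h => ofRealCLM.contDiff.comp_contDiffOn h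
    have hk : ∀ {f : ℂ → I3}, ContDiffOn ℝ ∞ f U → ContDiffOn ℝ ∞ (fun q => conj (horL (f q))) U :=
      fun h => (conjCLE.contDiff.comp horL.contDiff).comp_contDiffOn h
    refine ContDiffOn.mul (contDiffOn_const.mul (((hc (su' 0)).mul (hk sv)).sub
      ((hc (sv' 0)).mul (hk su)))) (hc (ContDiffOn.inv ?_ hJ0))
    exact ((su' 1).mul (sv' 2)).sub ((su' 2).mul (sv' 1))
  have hgre : ∀ q, (g q).re = (du X q 0 * dv X q 2 - dv X q 0 * du X q 2) * (J q)⁻¹ := by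
    intro q
    simp only [hg, re_mul_ofReal]
    simp
    left; ring
  have hgim : ∀ q, (g q).im = (du X q 0 * dv X q 1 - dv X q 0 * du X q 1) * (J q)⁻¹ := by
    intro q
    simp only [hg, im_mul_ofReal]
    simp
  have hdl : ∀ q ∈ U, ∀ w, fderiv ℝ X q w 0 = (g q * horL (fderiv ℝ X q w)).re := by
    intro q hq w
    have hw : w = w.re • 1 + w.im • I := by apply Complex.ext <;> simp
    have h0 := hJ0 q hq
    have h1 : fderiv ℝ X q w = w.re • du X q + w.im • dv X q := by
      conv_lhs => rw [hw, map_add, map_smul, map_smul]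
      rfl
    rw [h1, mul_re, hgre, hgim]
    simp
    field_simp
    simp only [hJ]
    ring
  have hbij := fun q hq => hX.bijective (q := q) hq
  -- The normalisation against `𝔭` gives the vertical direction coefficient one, and vanishing on
  -- the tangent plane then leaves only the covector `dl - Re (g dζ)`.
  have hform : ∀ q ∈ U, ∀ a : I3, mink (toMink a) (n q) = a 0 - (g q * horL a).re := by
    intro q hq a
    obtain ⟨⟨-, hn2, hn3⟩, -⟩ := hn q hq
    have h0 := hJ0 q hq
    have e1 := hn2 1
    have e2 := hn2 I
    change mink (toMink (du X q)) _ = 0 at e1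
    change mink (toMink (dv X q)) _ = 0 at e2
    simp [mink, toMink, pVec] at e1 e2 hn3
    rw [mul_re, hgre, hgim]
    simp [mink, toMink]
    have hn1 : n q 1 = -((du X q 0 * dv X q 2 - dv X q 0 * du X q 2) * (J q)⁻¹) := by
      field_simp
      simp only [hJ]
      linear_combination dv X q 2 * e1 - du X q 2 * e2
        - (du X q 0 * dv X q 2 - dv X q 0 * du X q 2) * hn3
    have hn2 : n q 2 = (du X q 0 * dv X q 1 - dv X q 0 * du X q 1) * (J q)⁻¹ := by
      field_simp
      simp only [hJ]
      linear_combination -dv X q 1 * e1 + du X q 1 * e2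
        + (du X q 0 * dv X q 1 - dv X q 0 * du X q 1) * hn3
    rw [hn1, hn2]
    linear_combination a 0 * hn3
  refine ⟨g, fun q => fderiv ℝ g q 1 / horL (du X q), hX.1, smg, hbij, hdl, ?_⟩
  intro q hq w
  have h0 := hJ0 q hq
  have hu0 : horL (du X q) ≠ 0 := fun h => one_ne_zero ((hbij q hq).1 (by simpa [du] using h))
  have hL : mink (toMink (du (du X) q)) (n q) = (fderiv ℝ g q 1 * horL (du X q)).re := by
    rw [hform q hq]; exact snd_height hU hX.1 smg hdl hq 1 1
  have hM : mink (toMink (du (dv X) q)) (n q) = (fderiv ℝ g q 1 * horL (dv X q)).re := by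
    rw [hform q hq]; exact snd_height hU hX.1 smg hdl hq I 1
  have hM' : mink (toMink (du (dv X) q)) (n q) = (fderiv ℝ g q I * horL (du X q)).re := by
    have : du (dv X) q = fderiv ℝ (fun p => fderiv ℝ X p 1) q I :=
      fderiv_fderiv_apply_comm hU hX.1 hq I 1
    rw [hform q hq, this]; exact snd_height hU hX.1 smg hdl hq 1 I
  have hN : mink (toMink (dv (dv X) q)) (n q) = (fderiv ℝ g q I * horL (dv X q)).re := by
    rw [hform q hq]; exact snd_height hU hX.1 smg hdl hq I I
  have hc := (hn q hq).2
  simp only [meanCurvature, hL, hM, hN, mink_toMink] at hc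
  have hMM := hM.symm.trans hM'
  have hden : 2 * ((du X q 1 * du X q 1 + du X q 2 * du X q 2)
      * (dv X q 1 * dv X q 1 + dv X q 2 * dv X q 2)
      - (du X q 1 * dv X q 1 + du X q 2 * dv X q 2) ^ 2) ≠ 0 := by
    have : 2 * ((du X q 1 * du X q 1 + du X q 2 * du X q 2)
      * (dv X q 1 * dv X q 1 + dv X q 2 * dv X q 2)
      - (du X q 1 * dv X q 1 + du X q 2 * dv X q 2) ^ 2) = 2 * J q ^ 2 := by simp only [hJ]; ring
    rw [this]; positivity
  have hc' := (div_eq_zero_iff.1 hc).resolve_right hden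
  -- The real part is the symmetry of mixed derivatives. The imaginary part is the numerator of the
  -- mean curvature up to a multiple of the real part, after multiplication by `J`.
  have heq : fderiv ℝ g q 1 * horL (dv X q) = fderiv ℝ g q I * horL (du X q) := by
    refine Complex.ext hMM (mul_left_cancel₀ h0 ?_)
    simp only [mul_re, mul_im, horL_re, horL_im, hJ] at *
    linear_combination hc' + (du X q 1 * dv X q 1 + du X q 2 * dv X q 2) * hMM
  have hw : w = w.re • 1 + w.im • I := by apply Complex.ext <;> simp
  have h1 : fderiv ℝ X q w = w.re • du X q + w.im • dv X q := by
    conv_lhs => rw [hw, map_add, map_smul, map_smul]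
    rfl
  have h2 : fderiv ℝ g q w = w.re • fderiv ℝ g q 1 + w.im • fderiv ℝ g q I := by
    conv_lhs => rw [hw, map_add, map_smul, map_smul]
  rw [h1, h2, map_add, map_smul, map_smul]
  simp only [real_smul]
  field_simp
  linear_combination (-(w.im : ℂ)) * heq

/-! ### The complex coordinate as a local chart; holomorphy of `g` and `P` -/

/-- `ψ` is a local inverse of the complex coordinate of `X` at `q₀`, defined on the disc of radius
`r`. -/
structure IsChart (U : Set ℂ) (X : ℂ → I3) (q₀ : ℂ) (r : ℝ) (ψ : ℂ → ℂ) : Prop where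
  pos : 0 < r
  map_center : ψ (horL (X q₀)) = q₀
  mem : ∀ z ∈ Metric.ball (horL (X q₀)) r, ψ z ∈ U
  right_inv : ∀ z ∈ Metric.ball (horL (X q₀)) r, horL (X (ψ z)) = z
  hasFDerivAt : ∀ z ∈ Metric.ball (horL (X q₀)) r, ∃ L : ℂ →L[ℝ] ℂ, HasFDerivAt ψ L z ∧
    ∀ w, horL (fderiv ℝ X (ψ z) (L w)) = w
  left_inv : ∀ᶠ q in 𝓝 q₀, horL (X q) ∈ Metric.ball (horL (X q₀)) r ∧ ψ (horL (X q)) = q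

theorem exists_isChart {U : Set ℂ} (hU : IsOpen U) {X : ℂ → I3} (hX : ContDiffOn ℝ ∞ X U)
    (hbij : ∀ q ∈ U, Function.Bijective fun w => horL (fderiv ℝ X q w)) {q₀ : ℂ} (hq₀ : q₀ ∈ U) :
    ∃ r ψ, IsChart U X q₀ r ψ := by
  have hζ : ContDiffOn ℝ ∞ (fun q => horL (X q)) U := horL.contDiff.comp_contDiffOn hX
  have hd : ∀ q ∈ U, HasFDerivAt (fun q => horL (X q)) (horL ∘L fderiv ℝ X q) q := fun q hq =>
    horL.hasFDerivAt.comp q (differentiableAt_of_contDiffOn hU hX hq).hasFDerivAt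
  let E : ∀ q ∈ U, ℂ ≃L[ℝ] ℂ := fun q hq =>
    (LinearEquiv.ofBijective (horL ∘L fderiv ℝ X q : ℂ →ₗ[ℝ] ℂ)
      (hbij q hq)).toContinuousLinearEquiv
  have hE : ∀ q (hq : q ∈ U), HasFDerivAt (fun q => horL (X q)) (E q hq : ℂ →L[ℝ] ℂ) q := by
    intro q hq
    convert! hd q hq using 1
  have hc := hζ.contDiffAt (hU.mem_nhds hq₀)
  set e := hc.toOpenPartialHomeomorph (fun q => horL (X q)) (hE q₀ hq₀) (by simp) with he
  have hcoe : ∀ q, e q = horL (X q) := fun q => rfl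
  have hmem : q₀ ∈ e.source := hc.mem_toOpenPartialHomeomorph_source (hE q₀ hq₀) (by simp)
  have hmem' : horL (X q₀) ∈ e.target := e.map_source hmem
  have hsymm : e.symm (horL (X q₀)) = q₀ := e.left_inv hmem
  have hcont : ContinuousAt e.symm (horL (X q₀)) := e.continuousAt_symm hmem'
  have hev : ∀ᶠ z in 𝓝 (horL (X q₀)), z ∈ e.target ∧ e.symm z ∈ U :=
    (e.open_target.eventually_mem hmem').and
      (hcont.eventually (by rw [hsymm]; exact hU.mem_nhds hq₀))
  obtain ⟨r, hr, hball⟩ := Metric.eventually_nhds_iff_ball.1 hev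
  refine ⟨r, e.symm, hr, hsymm, fun z hz => (hball z hz).2,
    fun z hz => e.right_inv (hball z hz).1, fun z hz => ?_, ?_⟩
  · refine ⟨_, e.hasFDerivAt_symm (hball z hz).1 (hE _ (hball z hz).2), fun w => ?_⟩
    exact (E _ (hball z hz).2).apply_symm_apply w
  · have h1 : ContinuousAt (fun q => horL (X q)) q₀ := hc.continuousAt
    filter_upwards [h1.eventually (Metric.ball_mem_nhds _ hr), e.open_source.mem_nhds hmem]
      with q hq hq'
    exact ⟨hq, e.left_inv hq'⟩

namespace IsChart

variable {U : Set ℂ} {X : ℂ → I3} {q₀ : ℂ} {r : ℝ} {ψ : ℂ → ℂ}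

theorem center_mem (h : IsChart U X q₀ r ψ) :
    horL (X q₀) ∈ Metric.ball (horL (X q₀)) r := Metric.mem_ball_self h.pos

/-- A function whose differential is a complex multiple of that of the coordinate is holomorphic
in a chart. -/
theorem hasDerivAt_comp (h : IsChart U X q₀ r ψ) {f f' : ℂ → ℂ}
    (hf : ∀ q ∈ U, DifferentiableAt ℝ f q)
    (hf' : ∀ q ∈ U, ∀ w, fderiv ℝ f q w = f' q * horL (fderiv ℝ X q w)) {z : ℂ}
    (hz : z ∈ Metric.ball (horL (X q₀)) r) :
    HasDerivAt (fun z => f (ψ z)) (f' (ψ z)) z := by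
  obtain ⟨L, hL, hLw⟩ := h.hasFDerivAt z hz
  have h1 : HasFDerivAt (fun z => f (ψ z)) (fderiv ℝ f (ψ z) ∘L L) z :=
    (hf _ (h.mem z hz)).hasFDerivAt.comp z hL
  refine hasDerivAt_iff_hasFDerivAt.2 (hasFDerivAt_of_restrictScalars ℝ h1 ?_)
  ext w
  simp [hf' _ (h.mem z hz), hLw, mul_comm]

theorem continuousOn (h : IsChart U X q₀ r ψ) :
    ContinuousOn ψ (Metric.ball (horL (X q₀)) r) := fun z hz =>
  let ⟨_, hL, _⟩ := h.hasFDerivAt z hz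
  hL.continuousAt.continuousWithinAt

end IsChart

/-- A holomorphic square root near a point where the function does not vanish. -/
theorem exists_sqrt_nhds {B : Set ℂ} (hB : IsOpen B) {f : ℂ → ℂ} (hf : DifferentiableOn ℂ f B)
    {z₀ : ℂ} (hz₀ : z₀ ∈ B) (h0 : f z₀ ≠ 0) :
    ∃ ρ > 0, Metric.ball z₀ ρ ⊆ B ∧ ∃ p : ℂ → ℂ, DifferentiableOn ℂ p (Metric.ball z₀ ρ) ∧
      ∀ z ∈ Metric.ball z₀ ρ, p z ≠ 0 ∧ p z ^ 2 = f z := by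
  obtain ⟨c, hc⟩ := IsAlgClosed.exists_pow_nat_eq (f z₀) two_pos
  have hc0 : c ≠ 0 := by rintro rfl; exact h0 (by simpa using hc.symm)
  have hcont : ContinuousAt (fun z => f z / f z₀) z₀ :=
    ((hf.differentiableAt (hB.mem_nhds hz₀)).div_const _).continuousAt
  have hev : ∀ᶠ z in 𝓝 z₀, z ∈ B ∧ f z / f z₀ ∈ slitPlane :=
    (hB.eventually_mem hz₀).and (hcont.eventually (isOpen_slitPlane.mem_nhds (by simp [h0])))
  obtain ⟨ρ, hρ, hball⟩ := Metric.eventually_nhds_iff_ball.1 hev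
  refine ⟨ρ, hρ, fun z hz => (hball z hz).1, fun z => c * exp (log (f z / f z₀) / 2), ?_, ?_⟩
  · intro z hz
    have h1 := (hf.differentiableAt (hB.mem_nhds (hball z hz).1)).div_const (f z₀)
    exact ((((h1.clog (hball z hz).2).div_const 2).cexp).const_mul c).differentiableWithinAt
  · intro z hz
    refine ⟨mul_ne_zero hc0 (exp_ne_zero _), ?_⟩
    rw [mul_pow, ← exp_nat_mul, hc]
    push_cast
    rw [mul_div_cancel₀ _ two_ne_zero, exp_log (slitPlane_ne_zero (hball z hz).2)]
    field_simp

namespace SurfaceData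

variable {U : Set ℂ} {X : ℂ → I3} {g P : ℂ → ℂ}

/-- The area of the coordinate frame. -/
theorem area_ne_zero (h : SurfaceData U X g P) {q : ℂ} (hq : q ∈ U) :
    du X q 1 * dv X q 2 - du X q 2 * dv X q 1 ≠ 0 := by
  simpa [du, dv] using Isotropic.area_ne_zero (L := horL ∘L fderiv ℝ X q) (h.bij q hq).1

/-- The three determinants are the coefficients of `J · Re (P dζ²)`, where `J` is the area of the
horizontal frame. Such a form is trace free with respect to `|dζ|²`, whence the negative sign. -/
theorem affineDisc_eq (hU : IsOpen U) (h : SurfaceData U X g P) {q : ℂ} (hq : q ∈ U) :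
    affineDisc X q = -((du X q 1 * dv X q 2 - du X q 2 * dv X q 1) ^ 4 * ‖P q‖ ^ 2) := by
  have hu : du X q 0 = (g q * horL (du X q)).re := h.dl q hq 1
  have hv : dv X q 0 = (g q * horL (dv X q)).re := h.dl q hq I
  have huu := snd_height hU h.smooth h.smooth_g h.dl hq 1 1
  have huv := snd_height hU h.smooth h.smooth_g h.dl hq I 1
  have hvv := snd_height hU h.smooth h.smooth_g h.dl hq I I
  rw [h.dg q hq] at huu huv hvv
  rw [affineDisc, det3_eq hu hv, det3_eq hu hv, det3_eq hu hv]
  change fderiv ℝ (du X) q 1 0 - (g q * horL (fderiv ℝ (du X) q 1)).re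
    = (P q * horL (du X q) * horL (du X q)).re at huu
  change fderiv ℝ (dv X) q 1 0 - (g q * horL (fderiv ℝ (dv X) q 1)).re
    = (P q * horL (du X q) * horL (dv X q)).re at huv
  change fderiv ℝ (dv X) q I 0 - (g q * horL (fderiv ℝ (dv X) q I)).re
    = (P q * horL (dv X q) * horL (dv X q)).re at hvv
  change _ * (fderiv ℝ (du X) q 1 0 - (g q * horL (fderiv ℝ (du X) q 1)).re)
    * (_ * (fderiv ℝ (dv X) q I 0 - (g q * horL (fderiv ℝ (dv X) q I)).re))
    - (_ * (fderiv ℝ (dv X) q 1 0 - (g q * horL (fderiv ℝ (dv X) q 1)).re)) ^ 2 = _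
  rw [huu, huv, hvv, ← normSq_eq_norm_sq, normSq_apply]
  simp only [mul_re, mul_im, horL_re, horL_im]
  ring

theorem mem_nondegenerateSet (hU : IsOpen U) (h : SurfaceData U X g P) {q : ℂ} :
    q ∈ nondegenerateSet U X ↔ q ∈ U ∧ P q ≠ 0 := by
  refine and_congr_right fun hq => ?_
  rw [h.affineDisc_eq hU hq]
  simp [h.area_ne_zero hq]

theorem mono {V : Set ℂ} (h : SurfaceData U X g P) (hVU : V ⊆ U) : SurfaceData V X g P :=
  ⟨h.smooth.mono hVU, h.smooth_g.mono hVU, fun q hq => h.bij q (hVU hq),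
    fun q hq => h.dl q (hVU hq), fun q hq => h.dg q (hVU hq)⟩

theorem exists_isChart (hU : IsOpen U) (h : SurfaceData U X g P) {q₀ : ℂ} (hq₀ : q₀ ∈ U) :
    ∃ r ψ, IsChart U X q₀ r ψ := Isotropic.exists_isChart hU h.smooth h.bij hq₀

theorem hasDerivAt_g (hU : IsOpen U) (h : SurfaceData U X g P) {q₀ : ℂ} {r : ℝ} {ψ : ℂ → ℂ}
    (hψ : IsChart U X q₀ r ψ) {z : ℂ} (hz : z ∈ Metric.ball (horL (X q₀)) r) :
    HasDerivAt (fun z => g (ψ z)) (P (ψ z)) z :=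
  hψ.hasDerivAt_comp (fun _ hq => differentiableAt_of_contDiffOn hU h.smooth_g hq) h.dg hz

theorem differentiableOn_P (hU : IsOpen U) (h : SurfaceData U X g P) {q₀ : ℂ} {r : ℝ} {ψ : ℂ → ℂ}
    (hψ : IsChart U X q₀ r ψ) :
    DifferentiableOn ℂ (fun z => P (ψ z)) (Metric.ball (horL (X q₀)) r) := by
  have h1 : DifferentiableOn ℂ (fun z => g (ψ z)) (Metric.ball (horL (X q₀)) r) := fun z hz =>
    (h.hasDerivAt_g hU hψ hz).differentiableAt.differentiableWithinAt
  exact (h1.deriv Metric.isOpen_ball).congr fun z hz => (h.hasDerivAt_g hU hψ hz).deriv.symm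

/-- `SurfaceData` asks for no regularity of `P`; it comes from `P` being the complex derivative of
the holomorphic `g`. It makes the set of non-degenerate points open. -/
theorem continuousAt_P (hU : IsOpen U) (h : SurfaceData U X g P) {q₀ : ℂ} (hq₀ : q₀ ∈ U) :
    ContinuousAt P q₀ := by
  obtain ⟨r, ψ, hψ⟩ := h.exists_isChart hU hq₀
  have h1 : ContinuousAt (fun z => P (ψ z)) (horL (X q₀)) :=
    ((h.differentiableOn_P hU hψ).differentiableAt
      (Metric.ball_mem_nhds _ hψ.pos)).continuousAt
  have h2 : ContinuousAt (fun q => horL (X q)) q₀ :=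
    (horL.continuous.continuousAt).comp
      (differentiableAt_of_contDiffOn hU h.smooth hq₀).continuousAt
  have h3 : ContinuousAt (fun q => P (ψ (horL (X q)))) q₀ :=
    ContinuousAt.comp (g := fun z => P (ψ z)) (f := fun q => horL (X q)) h1 h2
  refine h3.congr ?_
  filter_upwards [hψ.left_inv] with q hq
  rw [hq.2]

end SurfaceData

/-! ### From affine minimality to `P = (a g² + b g + c)²` -/

/-- The trace of a real linear map conjugated by a linear map and its inverse. -/
theorem re_add_im_eq_trace {L L' : ℂ →L[ℝ] ℂ} (hLL' : ∀ w, L' (L w) = w) (S : ℂ →ₗ[ℝ] ℂ) :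
    (L' (S (L 1))).re + (L' (S (L I))).im = LinearMap.trace ℝ ℂ S := by
  have h1 : (L : ℂ →ₗ[ℝ] ℂ) * (L' : ℂ →ₗ[ℝ] ℂ) = 1 :=
    mul_eq_one_comm.1 (LinearMap.ext hLL')
  have h2 : LinearMap.trace ℝ ℂ ((L' : ℂ →ₗ[ℝ] ℂ) * (S * (L : ℂ →ₗ[ℝ] ℂ)))
      = LinearMap.trace ℝ ℂ S := by
    rw [LinearMap.trace_mul_comm, mul_assoc, h1, mul_one]
  rw [← h2, LinearMap.trace_eq_matrix_trace ℝ basisOneI, Matrix.trace, Fin.sum_univ_two]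
  simp [LinearMap.toMatrix_apply]

/-- Near a non-degenerate point of an affine minimal surface, `P` is the square of a quadratic
polynomial in `g` with imaginary discriminant. -/
theorem IsAffineMinimal.exists_quadratic {U : Set ℂ} (hU : IsOpen U) {X : ℂ → I3} {g P : ℂ → ℂ}
    (h : SurfaceData U X g P) (hA : IsAffineMinimal U X) {q₁ : ℂ} (hq₁ : q₁ ∈ U)
    (hP : P q₁ ≠ 0) :
    ∃ a b c : ℂ, (b ^ 2 - 4 * a * c).re = 0 ∧
      ∀ᶠ q in 𝓝 q₁, P q = (a * g q ^ 2 + b * g q + c) ^ 2 := by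
  obtain ⟨ξ, ⟨hξs, hξ⟩, hH⟩ := hA
  set V := nondegenerateSet U X with hV
  have hVU : V ⊆ U := fun q hq => hq.1
  have hVo : IsOpen V := by
    rw [isOpen_iff_mem_nhds]
    intro q hq
    have hq' := (h.mem_nondegenerateSet hU).1 hq
    filter_upwards [hU.mem_nhds hq'.1, (h.continuousAt_P hU hq'.1).eventually_ne hq'.2]
      with y hy hy' using (h.mem_nondegenerateSet hU).2 ⟨hy, hy'⟩
  have hq₁V : q₁ ∈ V := (h.mem_nondegenerateSet hU).2 ⟨hq₁, hP⟩
  have hv := h.mono hVU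
  obtain ⟨r, ψ, hψ⟩ := hv.exists_isChart hVo hq₁V
  have hcm := hψ.center_mem
  obtain ⟨ρ, hρ, hρr, p, hp, hpP⟩ := exists_sqrt_nhds Metric.isOpen_ball
    (hv.differentiableOn_P hVo hψ) hcm (by rwa [hψ.map_center])
  set B := Metric.ball (horL (X q₁)) ρ with hB
  have hξd : ∀ z ∈ B, ∃ L : ℂ →L[ℝ] ℂ, HasFDerivAt ψ L z ∧
      (∀ w, horL (fderiv ℝ X (ψ z) (L w)) = w) ∧
      HasFDerivAt (fun z => ξ (ψ z)) (fderiv ℝ ξ (ψ z) ∘L L) z := by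
    intro z hz
    obtain ⟨L, hL, hLw⟩ := hψ.hasFDerivAt z (hρr hz)
    exact ⟨L, hL, hLw, (differentiableAt_of_contDiffOn hVo hξs
      (hψ.mem z (hρr hz))).hasFDerivAt.comp z hL⟩
  have hre : ∀ z ∈ B,
      (2 * deriv (deriv p) z / p z ^ 3 - 5 * deriv p z ^ 2 / p z ^ 4).re = 0 := by
    intro z hz
    -- `τ` is the height of the affine normal over the tangent plane, so `det (X_u, X_v, ξ) = J τ`.
    -- The volume condition with `affineDisc_eq` becomes `τ⁴ = ‖P‖² = ‖p‖⁴`.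
    refine re_schwarzian_eq_zero Metric.isOpen_ball hp (fun z hz => (hpP z hz).1)
      (τ := fun z => ξ (ψ z) 0 - (g (ψ z) * horL (ξ (ψ z))).re) ?_
      (ξ := fun z => horL (ξ (ψ z))) ?_ ?_ ?_ hz
    · intro z hz
      have hm := hψ.mem z (hρr hz)
      have h1 := (hξ _ hm).1
      have hj := hv.area_ne_zero hm
      have hu : du X (ψ z) 0 = (g (ψ z) * horL (du X (ψ z))).re := hv.dl _ hm 1
      have hv' : dv X (ψ z) 0 = (g (ψ z) * horL (dv X (ψ z))).re := hv.dl _ hm I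
      rw [det3_eq hu hv', hv.affineDisc_eq hVo hm,
        ← (hpP z hz).2, abs_neg, abs_of_nonneg (by positivity), norm_pow, mul_pow] at h1
      have h2 := mul_left_cancel₀ (pow_ne_zero 4 hj) h1
      rw [h2]; ring
    · intro z hz
      obtain ⟨L, hL, hLw, hd⟩ := hξd z hz
      exact (horL.hasFDerivAt.comp z hd).differentiableAt.differentiableWithinAt
    · intro z hz
      obtain ⟨L, hL, hLw, hd⟩ := hξd z hz
      have hm := hψ.mem z (hρr hz)
      obtain ⟨-, S, hS⟩ := hξ _ hm
      have hgd : HasFDerivAt (fun z => g (ψ z)) (fderiv ℝ g (ψ z) ∘L L) z :=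
        (differentiableAt_of_contDiffOn hVo hv.smooth_g hm).hasFDerivAt.comp z hL
      -- Since `dξ` is tangential, its vertical part cancels against `Re (g · dζ(dξ))`. Only the
      -- term with `dg = p² dζ` survives.
      refine ⟨_, (verL.hasFDerivAt.comp z hd).sub
        (reCLM.hasFDerivAt.comp z (hgd.mul (horL.hasFDerivAt.comp z hd))), fun w => ?_⟩
      have h1 := hS (L w)
      have h2 := hv.dl _ hm (S (L w))
      have h3 := hv.dg _ hm (L w)
      rw [hLw, ← (hpP z hz).2] at h3
      simp [h1, h2, h3]
      ring
    · intro z hz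
      obtain ⟨L, hL, hLw, hd⟩ := hξd z hz
      have hm := hψ.mem z (hρr hz)
      obtain ⟨-, S, hS⟩ := hξ _ hm
      have h1 := hH _ hm S hS
      -- In the chart, the differential of the horizontal part of `ξ` is `-S` conjugated by the
      -- coordinate change, so its divergence is minus the trace of `S`.
      have h2 := re_add_im_eq_trace (L' := horL ∘L fderiv ℝ X (ψ z)) hLw S
      have h3 : HasFDerivAt (fun z => horL (ξ (ψ z))) _ z := horL.hasFDerivAt.comp z hd
      rw [h3.fderiv]
      have h4 := hS (L 1)
      have h5 := hS (L I)
      simp only [ContinuousLinearMap.comp_apply] at h2 ⊢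
      rw [h4, h5, map_neg, map_neg, neg_re, neg_im]
      linarith
  obtain ⟨a, b, c, h1, h2⟩ := Isotropic.exists_quadratic Metric.isOpen_ball
    (convex_ball _ _).isPreconnected ⟨_, Metric.mem_ball_self hρ⟩ hp (fun z hz => (hpP z hz).1)
    (G := fun z => g (ψ z))
    (fun z hz => by rw [(hpP z hz).2]; exact hv.hasDerivAt_g hVo hψ (hρr hz)) hre
  refine ⟨a, b, c, h1, ?_⟩
  have hcont : ContinuousAt (fun q => horL (X q)) q₁ :=
    (horL.continuous.continuousAt).comp
      (differentiableAt_of_contDiffOn hU h.smooth hq₁).continuousAt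
  filter_upwards [hψ.left_inv, hcont.eventually (Metric.ball_mem_nhds _ hρ)] with q hq hq'
  have h3 := (hpP _ hq').2
  have h4 := h2 _ hq'
  rw [hq.2] at h3 h4
  rw [← h3, h4]

/-- A solution of `f' = k f ^ 2` which vanishes at a point vanishes identically near it. -/
theorem eventually_eq_zero_of_deriv_eq {B : Set ℂ} (hB : IsOpen B) {f k : ℂ → ℂ}
    (hf : DifferentiableOn ℂ f B) (hk : DifferentiableOn ℂ k B)
    (hfk : ∀ z ∈ B, deriv f z = k z * f z ^ 2) {z₀ : ℂ} (hz₀ : z₀ ∈ B) (h0 : f z₀ = 0) :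
    ∀ᶠ z in 𝓝 z₀, f z = 0 := by
  have af : AnalyticAt ℂ f z₀ := hf.analyticAt (hB.mem_nhds hz₀)
  have ak : AnalyticAt ℂ k z₀ := hk.analyticAt (hB.mem_nhds hz₀)
  rw [← analyticOrderAt_eq_top]
  -- A finite order `n` of the zero would give `ord k + 2 n + 1 = n`, which is impossible.
  have h1 := af.analyticOrderAt_deriv_add_one
  simp only [h0, sub_zero] at h1
  have h2 : analyticOrderAt (deriv f) z₀ = analyticOrderAt (k * f ^ 2) z₀ :=
    analyticOrderAt_congr (by
      filter_upwards [hB.mem_nhds hz₀] with z hz using hfk z hz)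
  rw [h2, analyticOrderAt_mul ak (af.pow 2), analyticOrderAt_pow af] at h1
  by_contra hne
  obtain ⟨n, hn⟩ := ENat.ne_top_iff_exists.1 hne
  change analyticOrderAt k z₀ + 2 • analyticOrderAt f z₀ + 1 = analyticOrderAt f z₀ at h1
  rw [← hn] at h1
  cases hkk : analyticOrderAt k z₀ with
  | top => rw [hkk] at h1; simp at h1
  | coe m =>
    rw [hkk] at h1
    have h3 : m + 2 * n + 1 = n := by
      have : ((m + 2 * n + 1 : ℕ) : ℕ∞) = n := by
        rw [← h1]; simp
      exact_mod_cast this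
    omega

namespace SurfaceData

variable {U : Set ℂ} {X : ℂ → I3} {g P : ℂ → ℂ}

/-- The identity theorem: a polynomial relation between `P` and `g` propagates over a connected
surface. -/
theorem eq_of_eventually_eq (hU : IsOpen U) (hUc : IsPreconnected U) (h : SurfaceData U X g P)
    {F : ℂ → ℂ} (hF : Differentiable ℂ F) {q₁ : ℂ} (hq₁ : q₁ ∈ U)
    (hev : ∀ᶠ q in 𝓝 q₁, P q = F (g q)) : ∀ q ∈ U, P q = F (g q) := by
  set W : Set ℂ := {q | ∀ᶠ q' in 𝓝 q, P q' = F (g q')} with hW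
  have hWo : IsOpen W := isOpen_setOfPred_eventually_nhds
  suffices U ⊆ W from fun q hq => (this hq).self_of_nhds
  refine hUc.subset_of_closure_inter_subset hWo ⟨q₁, hq₁, hev⟩ ?_
  rintro q₀ ⟨hq₀, hq₀U⟩
  obtain ⟨r, ψ, hψ⟩ := h.exists_isChart hU hq₀U
  -- Within the chart around a limit point `q₀` there is a point of `W`; the identity theorem on the
  -- disc carries the relation to all of the chart, so `W` is closed in `U`.
  obtain ⟨q', hq', hq'W⟩ := mem_closure_iff_nhds.1 hq₀ _ hψ.left_inv
  have hz' : horL (X q') ∈ Metric.ball (horL (X q₀)) r := hq'.1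
  have hgd : DifferentiableOn ℂ (fun z => g (ψ z)) (Metric.ball (horL (X q₀)) r) := fun z hz =>
    (h.hasDerivAt_g hU hψ hz).differentiableAt.differentiableWithinAt
  have h1 := (h.differentiableOn_P hU hψ).analyticOnNhd Metric.isOpen_ball
  have h2 := (hF.comp_differentiableOn hgd).analyticOnNhd Metric.isOpen_ball
  have hc : ContinuousAt ψ (horL (X q')) :=
    hψ.continuousOn.continuousAt (Metric.isOpen_ball.mem_nhds hz')
  have h3 := h1.eqOn_of_preconnected_of_eventuallyEq h2 (convex_ball _ _).isPreconnected hz'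
    (hc.eventually (p := fun q => P q = F (g q)) (by rw [hq'.2]; exact hq'W))
  filter_upwards [hψ.left_inv] with q hq
  simpa [hq.2] using h3 hq.1

/-- `P` has no zeros on a connected surface on which it is the square of a quadratic polynomial in
`g`, unless it vanishes identically. -/
theorem ne_zero_of_eq_quadratic_sq (hU : IsOpen U) (hUc : IsPreconnected U)
    (h : SurfaceData U X g P) {a b c : ℂ}
    (hP : ∀ q ∈ U, P q = (a * g q ^ 2 + b * g q + c) ^ 2) {q₁ : ℂ} (hq₁ : q₁ ∈ U)
    (hP₁ : P q₁ ≠ 0) : ∀ q ∈ U, P q ≠ 0 := by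
  intro q₀ hq₀ h0
  refine hP₁ (h.eq_of_eventually_eq hU hUc (F := fun _ => 0) (differentiable_const _) hq₀ ?_
    q₁ hq₁)
  obtain ⟨r, ψ, hψ⟩ := h.exists_isChart hU hq₀
  set B := Metric.ball (horL (X q₀)) r with hB
  have hgd : ∀ z ∈ B, HasDerivAt (fun z => g (ψ z)) (P (ψ z)) z := fun z hz =>
    h.hasDerivAt_g hU hψ hz
  have hgD : DifferentiableOn ℂ (fun z => g (ψ z)) B := fun z hz =>
    (hgd z hz).differentiableAt.differentiableWithinAt
  -- For `f = a g² + b g + c` the relation `g' = P = f²` gives `f' = (2 a g + b) f²`, so a zero of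
  -- `f` spreads to a neighbourhood.
  have hfd : ∀ z ∈ B, HasDerivAt (fun z => a * g (ψ z) ^ 2 + b * g (ψ z) + c)
      ((2 * a * g (ψ z) + b) * (a * g (ψ z) ^ 2 + b * g (ψ z) + c) ^ 2) z := by
    intro z hz
    have := ((((hgd z hz).pow 2).const_mul a).add ((hgd z hz).const_mul b)).add_const c
    convert! this using 1
    rw [hP _ (hψ.mem z hz)]
    simp
    ring
  have h1 := eventually_eq_zero_of_deriv_eq Metric.isOpen_ball
    (f := fun z => a * g (ψ z) ^ 2 + b * g (ψ z) + c) (k := fun z => 2 * a * g (ψ z) + b)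
    (fun z hz => (hfd z hz).differentiableAt.differentiableWithinAt)
    ((hgD.const_mul _).add_const _) (fun z hz => (hfd z hz).deriv) hψ.center_mem (by
      have := hP q₀ hq₀
      rw [h0] at this
      simp only [hψ.map_center]
      exact pow_eq_zero_iff two_ne_zero |>.1 this.symm)
  have hcont : ContinuousAt (fun q => horL (X q)) q₀ :=
    (horL.continuous.continuousAt).comp
      (differentiableAt_of_contDiffOn hU h.smooth hq₀).continuousAt
  filter_upwards [hcont.eventually h1, hψ.left_inv, hU.mem_nhds hq₀] with q hq hq' hqU
  rw [hq'.2] at hq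
  rw [hP q hqU, hq]
  simp

end SurfaceData

/-- A connected affine minimal surface with zero mean curvature is flat, or `P` is without zeros
and is the square of a quadratic polynomial in `g` with imaginary discriminant. -/
theorem IsAffineMinimal.eq_zero_or_exists_quadratic {U : Set ℂ} (hU : IsOpen U)
    (hUc : IsPreconnected U) {X : ℂ → I3} {g P : ℂ → ℂ}
    (h : SurfaceData U X g P) (hA : IsAffineMinimal U X) :
    (∀ q ∈ U, P q = 0) ∨ ∃ a b c : ℂ, (b ^ 2 - 4 * a * c).re = 0 ∧
      ∀ q ∈ U, P q = (a * g q ^ 2 + b * g q + c) ^ 2 ∧ P q ≠ 0 := by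
  by_cases hall : ∀ q ∈ U, P q = 0
  · exact .inl hall
  push Not at hall
  obtain ⟨q₁, hq₁, hP₁⟩ := hall
  obtain ⟨a, b, c, h1, h2⟩ := hA.exists_quadratic hU h hq₁ hP₁
  have h3 := h.eq_of_eventually_eq hU hUc (F := fun w => (a * w ^ 2 + b * w + c) ^ 2)
    (by fun_prop) hq₁ h2
  exact .inr ⟨a, b, c, h1, fun q hq =>
    ⟨h3 q hq, h.ne_zero_of_eq_quadratic_sq hU hUc h3 hq₁ hP₁ q hq⟩⟩

/-! ### Similarities of isotropic space -/

/-- The similarity `(l, ζ) ↦ (r (l + Re (m ζ)), r u ζ) + t`. -/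
noncomputable def simMap (r : ℝ) (u m : ℂ) (t : I3) (Q : I3) : I3 :=
  ![r * (Q 0 + (m * horL Q).re), (r * (u * horL Q)).re, (r * (u * horL Q)).im] + t

@[simp] theorem simMap_zero (r : ℝ) (u m : ℂ) (t Q : I3) :
    simMap r u m t Q 0 = r * (Q 0 + (m * horL Q).re) + t 0 := rfl

@[simp] theorem horL_simMap (r : ℝ) (u m : ℂ) (t Q : I3) :
    horL (simMap r u m t Q) = r * (u * horL Q) + horL t := by
  apply Complex.ext <;> simp [simMap] <;> rfl

/-- The linear isometry of Minkowski space which restricts to `(l, ζ) ↦ (l + Re (m ζ), u ζ)`: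
the composition of a null rotation and a rotation. -/
noncomputable def nullRotation (u m : ℂ) : Minkowski →ₗ[ℝ] Minkowski where
  toFun Q :=
    ![Q 0 + (m.re * Q 1 - m.im * Q 2) - (Q 3 - Q 0) * (m.re ^ 2 + m.im ^ 2) / 2,
      u.re * (Q 1 - (Q 3 - Q 0) * m.re) - u.im * (Q 2 + (Q 3 - Q 0) * m.im),
      u.im * (Q 1 - (Q 3 - Q 0) * m.re) + u.re * (Q 2 + (Q 3 - Q 0) * m.im),
      Q 3 + (m.re * Q 1 - m.im * Q 2) - (Q 3 - Q 0) * (m.re ^ 2 + m.im ^ 2) / 2]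
  map_add' Q R := by ext i; fin_cases i <;> simp <;> ring
  map_smul' c Q := by ext i; fin_cases i <;> simp <;> ring

theorem isSimilarity_simMap {r : ℝ} (hr : 0 < r) {u : ℂ} (hu : ‖u‖ = 1) (m : ℂ) (t : I3) :
    IsSimilarity (simMap r u m t) := by
  have hu' : u.re * u.re + u.im * u.im = 1 := by
    rw [← normSq_apply, normSq_eq_norm_sq, hu, one_pow]
  refine ⟨r, simMap 1 u m t, hr, ⟨nullRotation u m, t, ?_, ?_, ?_⟩, fun Q => ?_⟩
  · intro Q R
    simp [nullRotation, mink]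
    linear_combination ((Q 1 - (Q 3 - Q 0) * m.re) * (R 1 - (R 3 - R 0) * m.re)
      + (Q 2 + (Q 3 - Q 0) * m.im) * (R 2 + (R 3 - R 0) * m.im)) * hu'
  · ext i; fin_cases i <;> simp [nullRotation, pVec]
  · intro Q
    ext i; fin_cases i <;> simp [nullRotation, toMink, simMap]
    ring
  · refine ext_horL ?_ ?_
    · simp; ring
    · simp; ring

/-- The reflection `(l, ζ) ↦ (l, conj ζ)`. -/
def refl (Q : I3) : I3 := ![Q 0, Q 1, -Q 2]

@[simp] theorem refl_zero (Q : I3) : refl Q 0 = Q 0 := rfl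

@[simp] theorem horL_refl (Q : I3) : horL (refl Q) = conj (horL Q) := by
  apply Complex.ext <;> simp [refl]

theorem refl_refl (Q : I3) : refl (refl Q) = Q := ext_horL (by simp) (by simp)

/-- The reflection as a continuous linear map. -/
noncomputable def reflL : I3 →L[ℝ] I3 := LinearMap.toContinuousLinearMap
  { toFun := refl
    map_add' := fun Q R => by ext i; fin_cases i <;> simp [refl]; ring
    map_smul' := fun c Q => by ext i; fin_cases i <;> simp [refl] }

@[simp] theorem reflL_apply (Q : I3) : reflL Q = refl Q := rfl

/-- The reflection of Minkowski space which restricts to `refl`. -/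
noncomputable def minkRefl : Minkowski →ₗ[ℝ] Minkowski where
  toFun Q := ![Q 0, Q 1, -Q 2, Q 3]
  map_add' Q R := by ext i; fin_cases i <;> simp; ring
  map_smul' c Q := by ext i; fin_cases i <;> simp

theorem IsSimilarity.refl_comp {T : I3 → I3} (hT : IsSimilarity T) :
    IsSimilarity fun Q => refl (T Q) := by
  obtain ⟨r, S, hr, ⟨A, t, hA, hAp, hS⟩, hT⟩ := hT
  refine ⟨r, fun Q => refl (S Q), hr, ⟨minkRefl ∘ₗ A, refl t, ?_, ?_, ?_⟩,
    fun Q => congrArg refl (hT Q)⟩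
  · intro Q R
    rw [← hA Q R]
    simp [minkRefl, mink]
  · rw [LinearMap.comp_apply, hAp]
    ext i; fin_cases i <;> simp [minkRefl, pVec]
  · intro Q
    have h := hS Q
    have h0 := congrFun h 0
    have h1 := congrFun h 1
    have h2 := congrFun h 2
    have h3 := congrFun h 3
    simp [toMink] at h0 h1 h2 h3
    ext i; fin_cases i <;> simp [minkRefl, refl, toMink]
    · exact h0
    · exact h1
    · rw [h2]; ring
    · exact h3

theorem IsPieceOf.of_refl {U : Set ℂ} {X : ℂ → I3} {D : WData}
    (h : IsPieceOf U (fun q => refl (X q)) D) : IsPieceOf U X D := by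
  obtain ⟨Y, T, φ, hY, hT, hφ, hq⟩ := h
  refine ⟨Y, _, φ, hY, hT.refl_comp, hφ, fun q hqU => ?_⟩
  obtain ⟨h1, h2, h3⟩ := hq q hqU
  exact ⟨h1, h2, by rw [← h3, refl_refl]⟩

/-- Conjugation of `g` and `P` conjugates the coefficients of the quadratic polynomial, and so
reverses the sign of its imaginary discriminant. -/
theorem SurfaceData.refl {U : Set ℂ} (hU : IsOpen U) {X : ℂ → I3} {g P : ℂ → ℂ}
    (h : SurfaceData U X g P) :
    SurfaceData U (fun q => refl (X q)) (fun q => conj (g q)) (fun q => conj (P q)) := by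
  have hX : ∀ q ∈ U, fderiv ℝ (fun q => Isotropic.refl (X q)) q = reflL ∘L fderiv ℝ X q :=
    fun q hq => (reflL.hasFDerivAt.comp q
      (differentiableAt_of_contDiffOn hU h.smooth hq).hasFDerivAt).fderiv
  have hg : ∀ q ∈ U, fderiv ℝ (fun q => conj (g q)) q = (conjCLE : ℂ →L[ℝ] ℂ) ∘L fderiv ℝ g q :=
    fun q hq => ((conjCLE : ℂ →L[ℝ] ℂ).hasFDerivAt.comp q
      (differentiableAt_of_contDiffOn hU h.smooth_g hq).hasFDerivAt).fderiv
  refine ⟨reflL.contDiff.comp_contDiffOn h.smooth, conjCLE.contDiff.comp_contDiffOn h.smooth_g,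
    ?_, ?_, ?_⟩
  · intro q hq
    simp only [hX q hq, ContinuousLinearMap.comp_apply, reflL_apply, horL_refl]
    exact (starRingAut (R := ℂ)).bijective.comp (h.bij q hq)
  · intro q hq w
    simp only [hX q hq, ContinuousLinearMap.comp_apply, reflL_apply, horL_refl, refl_zero]
    rw [h.dl q hq, ← map_mul, conj_re]
  · intro q hq w
    simp only [hX q hq, hg q hq, ContinuousLinearMap.comp_apply, reflL_apply, horL_refl]
    simp [h.dg q hq]

/-! ### Recognition of a surface from its Weierstrass data -/

/-- The differential of the surface with given Weierstrass data after a reparametrization. -/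
theorem WData.IsSurface.hasFDerivAt {D : WData} {Y : ℂ → I3} (hY : D.IsSurface Y) {U : Set ℂ}
    (hU : IsOpen U) {φ : ℂ → ℂ} (hreg : ∀ q ∈ U, φ q ∈ D.regularSet) {q : ℂ} (hq : q ∈ U)
    {φ' : ℂ →L[ℝ] ℂ} (hφ : HasFDerivAt φ φ' q) :
    (∃ L : ℂ →L[ℝ] ℝ, HasFDerivAt (fun q => Y (φ q) 0) L q ∧
      ∀ w, L w = (D.h (φ q) * (D.η (φ q) * φ' w)).re) ∧
    ∃ L : ℂ →L[ℝ] ℂ, HasFDerivAt (fun q => horL (Y (φ q))) L q ∧ ∀ w, L w = D.η (φ q) * φ' w := by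
  obtain ⟨Φ, hΦ⟩ := hY
  obtain ⟨h0, h1, h2, -⟩ := hΦ _ (hreg q hq)
  have hk : ∀ {k c}, HasDerivAt (Φ k) c (φ q) → HasFDerivAt (fun q => Y (φ q) k)
      (reCLM ∘L ((ContinuousLinearMap.toSpanSingleton ℂ c).restrictScalars ℝ) ∘L φ') q := by
    intro k c h
    have h3 := reCLM.hasFDerivAt.comp q ((h.hasFDerivAt.restrictScalars ℝ).comp q hφ)
    refine h3.congr_of_eventuallyEq ?_
    filter_upwards [hU.mem_nhds hq] with y hy using (hΦ _ (hreg y hy)).2.2.2 k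
  refine ⟨⟨_, hk h0, fun w => ?_⟩, ?_⟩
  · simp; ring
  · have h3 := ((ofRealCLM.hasFDerivAt.comp q (hk h1)).add
      ((ofRealCLM.hasFDerivAt.comp q (hk h2)).const_mul I))
    refine ⟨_, h3.congr_of_eventuallyEq (.of_forall fun y => ?_), fun w => ?_⟩
    · apply Complex.ext <;> simp
    · apply Complex.ext
      · simp; ring
      · simp; ring

/-- The differential of a surface is determined by `g` and `dζ`. After the rotation `u`, the scaling
`r` and the shear `m`, the two surfaces have equal differentials and, over a connected domain,
differ by a translation. -/
theorem isPieceOf_of_fderiv {U : Set ℂ} (hU : IsOpen U) (hUc : IsPreconnected U) {X : ℂ → I3}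
    {g P : ℂ → ℂ} (h : SurfaceData U X g P) {D : WData} {Y : ℂ → I3} (hY : D.IsSurface Y)
    {φ : ℂ → ℂ} (hφ : ContDiffOn ℝ ∞ φ U) (hreg : ∀ q ∈ U, φ q ∈ D.regularSet) {r : ℝ}
    (hr : 0 < r) {u : ℂ} (hu : ‖u‖ = 1) (m : ℂ)
    (hd : ∀ q ∈ U, ∀ w, horL (fderiv ℝ X q w) = r * (u * (D.η (φ q) * fderiv ℝ φ q w)))
    (hg : ∀ q ∈ U, u * g q = D.h (φ q) + m) : IsPieceOf U X D := by
  have hφd := fun q (hq : q ∈ U) => hY.hasFDerivAt hU hreg hq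
    (differentiableAt_of_contDiffOn hU hφ hq).hasFDerivAt
  have hXd : ∀ q ∈ U, HasFDerivAt X (fderiv ℝ X q) q := fun q hq =>
    (differentiableAt_of_contDiffOn hU h.smooth hq).hasFDerivAt
  have hver : ∃ a : ℝ, ∀ q ∈ U, X q 0 - simMap r u m 0 (Y (φ q)) 0 = a := by
    have : ∀ q ∈ U, HasFDerivAt (fun q => X q 0 - simMap r u m 0 (Y (φ q)) 0)
        (0 : ℂ →L[ℝ] ℝ) q := by
      intro q hq
      obtain ⟨⟨L₀, hL₀, hL₀w⟩, L₁, hL₁, hL₁w⟩ := hφd q hq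
      have h1 := (verL.hasFDerivAt.comp q (hXd q hq)).sub
        ((hL₀.add (reCLM.hasFDerivAt.comp q (hL₁.const_mul m))).const_mul r)
      convert! h1 using 1
      · ext q; simp
      · symm
        ext1 w
        have e : fderiv ℝ X q w 0 = (u * g q * (r * (D.η (φ q) * fderiv ℝ φ q w))).re := by
          rw [h.dl q hq, hd q hq]; congr 1; ring
        rw [hg q hq] at e
        simp only [sub_apply, ContinuousLinearMap.comp_apply, verL_apply, e,
          smul_apply, add_apply, hL₀w, hL₁w, reCLM_apply,
          smul_eq_mul, zero_apply]
        rw [← add_re, ← re_ofReal_mul, ← sub_re]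
        ring_nf
        simp
    exact hU.exists_is_const_of_fderiv_eq_zero (𝕜 := ℝ) hUc
      (fun q hq => (this q hq).differentiableAt.differentiableWithinAt)
      fun q hq => (this q hq).fderiv
  have hhor : ∃ a : ℂ, ∀ q ∈ U, horL (X q) - horL (simMap r u m 0 (Y (φ q))) = a := by
    have : ∀ q ∈ U, HasFDerivAt (fun q => horL (X q) - horL (simMap r u m 0 (Y (φ q))))
        (0 : ℂ →L[ℝ] ℂ) q := by
      intro q hq
      obtain ⟨-, L₁, hL₁, hL₁w⟩ := hφd q hq
      have h1 := (horL.hasFDerivAt.comp q (hXd q hq)).sub ((hL₁.const_mul u).const_mul (r : ℂ))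
      convert! h1 using 1
      · ext q; simp
      · symm
        ext1 w
        simp [hd q hq, hL₁w]
    exact hU.exists_is_const_of_fderiv_eq_zero (𝕜 := ℝ) hUc
      (fun q hq => (this q hq).differentiableAt.differentiableWithinAt)
      fun q hq => (this q hq).fderiv
  obtain ⟨a, ha⟩ := hver
  obtain ⟨b, hb⟩ := hhor
  refine ⟨Y, simMap r u m ![a, b.re, b.im], φ, hY, isSimilarity_simMap hr hu m _, hφ,
    fun q hq => ⟨hreg q hq, ?_, ?_⟩⟩
  · have hinj : Function.Injective (fderiv ℝ φ q : ℂ →ₗ[ℝ] ℂ) := by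
      rw [injective_iff_map_eq_zero]
      intro w hw
      refine (h.bij q hq).1 ?_
      have hw' : fderiv ℝ φ q w = 0 := hw
      simp only [hd q hq w, hw', map_zero, mul_zero]
    exact ⟨hinj, LinearMap.injective_iff_surjective.1 hinj⟩
  · have ht : horL ![a, b.re, b.im] = b := by apply Complex.ext <;> simp
    refine ext_horL ?_ ?_
    · have := ha q hq
      simp at this
      simp [← this]
    · have := hb q hq
      simp at this
      rw [horL_simMap, ht, ← this]
      ring

/-- A surface without flat points is a piece of the surface with data `(h, η dz)` if the
function `g`, up to a motion, is `h ∘ φ` and the derivative of `h` is proportional to `P η`. -/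
theorem isPieceOf_of_deriv {U : Set ℂ} (hU : IsOpen U) (hUc : IsPreconnected U) {X : ℂ → I3}
    {g P : ℂ → ℂ} (h : SurfaceData U X g P) (hP : ∀ q ∈ U, P q ≠ 0) {D : WData} {Y : ℂ → I3}
    (hY : D.IsSurface Y) {φ : ℂ → ℂ} (hφ : ContDiffOn ℝ ∞ φ U)
    (hreg : ∀ q ∈ U, φ q ∈ D.regularSet) {r : ℝ} (hr : 0 < r) {u : ℂ} (hu : ‖u‖ = 1) (m : ℂ)
    (hg : ∀ q ∈ U, u * g q = D.h (φ q) + m)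
    (hD : ∀ q ∈ U, HasDerivAt D.h (r * u ^ 2 * P q * D.η (φ q)) (φ q)) : IsPieceOf U X D := by
  have hu0 : u ≠ 0 := by rintro rfl; simp at hu
  refine isPieceOf_of_fderiv hU hUc h hY hφ hreg hr hu m (fun q hq w => ?_) hg
  have h1 : HasFDerivAt (fun q => u * g q) (u • fderiv ℝ g q) q :=
    (differentiableAt_of_contDiffOn hU h.smooth_g hq).hasFDerivAt.const_mul u
  have h2 := (((hD q hq).hasFDerivAt.restrictScalars ℝ).comp q
    (differentiableAt_of_contDiffOn hU hφ hq).hasFDerivAt).add_const m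
  have h3 := h1.unique (h2.congr_of_eventuallyEq (by
    filter_upwards [hU.mem_nhds hq] with y hy using hg y hy))
  have h4 := congrArg (fun L => L w) h3
  simp [h.dg q hq] at h4
  have := hP q hq
  apply mul_left_cancel₀ (mul_ne_zero hu0 this)
  linear_combination h4

/-- A smooth nowhere vanishing function on a simply connected domain has a smooth logarithm. -/
theorem exists_smooth_log {U : Set ℂ} (hU : IsOpen U) (hsc : IsSimplyConnected U) {f : ℂ → ℂ}
    (hf : ContDiffOn ℝ ∞ f U) (h0 : ∀ q ∈ U, f q ≠ 0) :
    ∃ L : ℂ → ℂ, ContDiffOn ℝ ∞ L U ∧ ∀ q ∈ U, exp (L q) = f q := by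
  obtain ⟨L, hLc, hL⟩ := exists_continuousOn_eqOn_exp_comp hsc hU hf.continuousOn
    (by rintro ⟨q, hq, hq0⟩; exact h0 q hq hq0)
  have hL' : ∀ q ∈ U, exp (L q) = f q := fun q hq => hL hq
  refine ⟨L, fun q₀ hq₀ => ContDiffAt.contDiffWithinAt ?_, hL'⟩
  have hfa : ContDiffAt ℝ ∞ (fun q => f q / f q₀) q₀ :=
    (hf.contDiffAt (hU.mem_nhds hq₀)).div_const _
  have hlog : ContDiffAt ℝ ∞ log (f q₀ / f q₀) :=
    (contDiffAt_log (n := ∞) (by simp [h0 q₀ hq₀])).restrict_scalars ℝ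
  have h1 : ContDiffAt ℝ ∞ (fun q => log (f q / f q₀) + L q₀) q₀ :=
    (hlog.comp q₀ hfa).add contDiffAt_const
  have hc : ContinuousAt (fun q => (L q - L q₀).im) q₀ :=
    continuous_im.continuousAt.comp
      ((hLc.continuousAt (hU.mem_nhds hq₀)).sub continuousAt_const)
  refine h1.congr_of_eventuallyEq ?_
  -- Near `q₀` the continuous logarithm differs from `L q₀` by less than `π` in its imaginary part,
  -- so the difference is the principal logarithm of `f q / f q₀`, which is smooth.
  filter_upwards [hU.mem_nhds hq₀, hc.eventually (Ioo_mem_nhds (a := -Real.pi) (b := Real.pi)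
    (by simp [Real.pi_pos]) (by simp [Real.pi_pos]))] with q hq hq'
  rw [← hL' q hq, ← hL' q₀ hq₀, ← exp_sub, log_exp hq'.1 hq'.2.le]
  ring

/-! ### The surfaces -/

/-- Primitives of `h η` and `η` suffice, the third being `-i` times the second. The entry `Φ 2` is
never read. -/
theorem WData.exists_isSurface {D : WData} (Φ : Fin 3 → ℂ → ℂ)
    (h : ∀ z ∈ D.regularSet, HasDerivAt (Φ 0) (D.h z * D.η z) z ∧ HasDerivAt (Φ 1) (D.η z) z) :
    ∃ Y, D.IsSurface Y :=
  ⟨fun z => ![(Φ 0 z).re, (Φ 1 z).re, (-I * Φ 1 z).re], ![Φ 0, Φ 1, fun z => -I * Φ 1 z],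
    fun z hz => ⟨(h z hz).1, (h z hz).2, (h z hz).2.const_mul _, fun k => by fin_cases k <;> rfl⟩⟩

theorem exists_isSurface_plane : ∃ Y, planeData.IsSurface Y :=
  WData.exists_isSurface ![fun _ => 0, id, id] fun z _ => by
    simpa [planeData] using And.intro (hasDerivAt_const z (0 : ℂ)) (hasDerivAt_id z)

theorem exists_isSurface_trivialEnneper : ∃ Y, trivialEnneperData.IsSurface Y :=
  WData.exists_isSurface ![fun z => I * z ^ 2 / 2, fun z => I * z, 0] fun z _ => by
    constructor
    · convert! (((hasDerivAt_id z).pow 2).const_mul I).div_const 2 using 1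
      simp [trivialEnneperData]; ring
    · convert! (hasDerivAt_id z).const_mul I using 1
      simp [trivialEnneperData]

theorem exists_isSurface_helicoid : ∃ Y, helicoidData.IsSurface Y :=
  WData.exists_isSurface ![fun z => I * z, fun z => -I * exp (-z), 0] fun z _ => by
    constructor
    · convert! (hasDerivAt_id z).const_mul I using 1
      simp only [helicoidData]
      rw [mul_left_comm, ← exp_add, add_neg_cancel, exp_zero]
    · convert! ((hasDerivAt_id z).neg.cexp).const_mul (-I) using 1
      simp [helicoidData]

theorem exists_isSurface_enneper : ∃ Y, enneperData.IsSurface Y :=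
  WData.exists_isSurface ![fun z => I * z ^ 2 / 2, fun z => I * z ^ 3 / 3, 0] fun z hz => by
    have hz0 : z ≠ 0 := by rintro rfl; simp [WData.regularSet, enneperData] at hz
    constructor
    · convert! (((hasDerivAt_id z).pow 2).const_mul I).div_const 2 using 1
      simp [enneperData]; field_simp
    · convert! (((hasDerivAt_id z).pow 3).const_mul I).div_const 3 using 1
      simp [enneperData]; ring

theorem hasDerivAt_sinh_half (α : ℝ) (z : ℂ) :
    HasDerivAt (fun z : ℂ => sinh (α * z / 2)) (cosh (α * z / 2) * (α / 2)) z := by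
  have := (((hasDerivAt_id z).const_mul (α : ℂ)).div_const 2).csinh
  simpa using this

theorem hasDerivAt_cosh_half (α : ℝ) (z : ℂ) :
    HasDerivAt (fun z : ℂ => cosh (α * z / 2)) (sinh (α * z / 2) * (α / 2)) z := by
  have := (((hasDerivAt_id z).const_mul (α : ℂ)).div_const 2).ccosh
  simpa using this

theorem exists_isSurface_thomsen {α β : ℝ} (hα : 0 < α) (hβ : 0 < β) :
    ∃ Y, (thomsenData α β).IsSurface Y :=
  WData.exists_isSurface ![fun z => I * (2 / α ^ 2) * sinh (α * z / 2) ^ 2,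
    fun z => I * (2 * β / α ^ 2 : ℂ) * (sinh (α * z / 2) * cosh (α * z / 2) / α - z / 2), 0]
    fun z hz => by
    have hα' : (α : ℂ) ≠ 0 := by exact_mod_cast hα.ne'
    have hβ' : (β : ℂ) ≠ 0 := by exact_mod_cast hβ.ne'
    have hs : sinh (α * z / 2) ≠ 0 := by
      intro h0; simp [WData.regularSet, thomsenData, h0] at hz
    constructor
    · convert! ((hasDerivAt_sinh_half α z).pow 2).const_mul (I * (2 / α ^ 2)) using 1
      simp [thomsenData]; field_simp
    · convert! ((((hasDerivAt_sinh_half α z).mul (hasDerivAt_cosh_half α z)).div_const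
        (α : ℂ)).sub ((hasDerivAt_id z).div_const 2)).const_mul
          (I * (2 * β / α ^ 2 : ℂ)) using 1
      have := cosh_sq (α * z / 2)
      simp only [thomsenData]
      field_simp
      linear_combination (-1 : ℂ) * this

theorem hasDerivAt_trivialEnneper (z : ℂ) : HasDerivAt trivialEnneperData.h 1 z :=
  hasDerivAt_id z

theorem hasDerivAt_helicoid (z : ℂ) : HasDerivAt helicoidData.h (exp z) z :=
  hasDerivAt_exp z

theorem hasDerivAt_enneper {z : ℂ} (hz : z ≠ 0) : HasDerivAt enneperData.h (-(1 / z ^ 2)) z := by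
  convert! hasDerivAt_inv hz using 1
  · ext z; simp [enneperData]
  · simp

theorem hasDerivAt_thomsen (α β : ℝ) {z : ℂ} (hz : sinh (α * z / 2) ≠ 0) :
    HasDerivAt (thomsenData α β).h (-((α / β : ℂ) * (α / 2) / sinh (α * z / 2) ^ 2)) z := by
  convert! ((hasDerivAt_cosh_half α z).div (hasDerivAt_sinh_half α z) hz).const_mul
    (α / β : ℂ) using 1
  have := cosh_sq (α * z / 2)
  field_simp
  linear_combination (α : ℂ) ^ 2 / β * this

/-! ### Existence -/

theorem exists_sq_eq_of_norm_eq_one {v : ℂ} (hv : ‖v‖ = 1) : ∃ u : ℂ, u ^ 2 = v ∧ ‖u‖ = 1 := by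
  obtain ⟨u, hu⟩ := IsAlgClosed.exists_pow_nat_eq v two_pos
  refine ⟨u, hu, ?_⟩
  rw [← hu, norm_pow] at hv
  exact (pow_eq_one_iff_of_nonneg (norm_nonneg _) two_ne_zero).1 hv

theorem SurfaceData.exists_piece_plane {U : Set ℂ} (hU : IsOpen U) (hUc : IsPreconnected U)
    {X : ℂ → I3} {g P : ℂ → ℂ} (h : SurfaceData U X g P)
    (hP : ∀ q ∈ U, P q = 0) : IsPieceOf U X planeData := by
  obtain ⟨Y, hY⟩ := exists_isSurface_plane
  obtain ⟨m, hm⟩ : ∃ m, ∀ q ∈ U, g q = m := by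
    refine hU.exists_is_const_of_fderiv_eq_zero (𝕜 := ℝ) hUc
      (fun q hq => (differentiableAt_of_contDiffOn hU h.smooth_g hq).differentiableWithinAt)
      fun q hq => ?_
    ext1 w
    simp [h.dg q hq, hP q hq]
  refine isPieceOf_of_fderiv hU hUc h hY (φ := fun q => horL (X q))
    (horL.contDiff.comp_contDiffOn h.smooth) (fun q hq => by simp [WData.regularSet, planeData])
    one_pos (u := 1) (by simp) m (fun q hq w => ?_) fun q hq => by simp [planeData, hm q hq]
  have h1 : HasFDerivAt (fun q => horL (X q)) (horL ∘L fderiv ℝ X q) q :=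
    horL.hasFDerivAt.comp q (differentiableAt_of_contDiffOn hU h.smooth hq).hasFDerivAt
  simp [h1.fderiv, planeData]

theorem SurfaceData.exists_piece_trivialEnneper {U : Set ℂ} (hU : IsOpen U)
    (hUc : IsPreconnected U) {X : ℂ → I3} {g P : ℂ → ℂ} (h : SurfaceData U X g P) {c : ℂ}
    (hc : c ≠ 0) (hP : ∀ q ∈ U, P q = c ^ 2) : IsPieceOf U X trivialEnneperData := by
  obtain ⟨Y, hY⟩ := exists_isSurface_trivialEnneper
  have hn : ‖c‖ ≠ 0 := by simpa using hc
  -- With `φ = u g`, the condition `h' = r u² P η` reads `1 = r u² c² i`; `r` takes the modulus and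
  -- `u` the argument.
  obtain ⟨u, hu2, hu⟩ := exists_sq_eq_of_norm_eq_one (v := -I * ‖c‖ ^ 2 / c ^ 2) (by simp [hc])
  have hn' : (‖c‖ : ℂ) ≠ 0 := by exact_mod_cast hn
  refine isPieceOf_of_deriv hU hUc h (fun q hq => by rw [hP q hq]; exact pow_ne_zero 2 hc) hY
    (φ := fun q => u * g q) (contDiffOn_const.mul h.smooth_g)
    (fun q hq => by simp [WData.regularSet, trivialEnneperData])
    (r := (‖c‖ ^ 2)⁻¹) (by positivity) hu 0 (fun q hq => by simp [trivialEnneperData])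
    fun q hq => ?_
  convert! hasDerivAt_trivialEnneper _ using 1
  rw [hu2, hP q hq]
  simp only [trivialEnneperData]
  push_cast
  field_simp
  simp

theorem SurfaceData.exists_piece_helicoid {U : Set ℂ} (hU : IsOpen U) (hsc : IsSimplyConnected U)
    {X : ℂ → I3} {g P : ℂ → ℂ} (h : SurfaceData U X g P) {b c : ℂ} {δ : ℝ} (hδ : 0 < δ)
    (hb : b ^ 2 = -I * δ) (hP : ∀ q ∈ U, P q = (b * g q + c) ^ 2) (hP0 : ∀ q ∈ U, P q ≠ 0) :
    IsPieceOf U X helicoidData := by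
  have hUc := hsc.isPathConnected.isConnected.isPreconnected
  obtain ⟨Y, hY⟩ := exists_isSurface_helicoid
  have hδ' : (δ : ℂ) ≠ 0 := by exact_mod_cast hδ.ne'
  have hb0 : b ≠ 0 := by rintro rfl; simp [hδ'] at hb
  -- `e^φ` has to be `g` up to a translation, and `-c/b` is the zero of the linear polynomial, which
  -- `g` omits since `P ≠ 0`.
  obtain ⟨φ, hφ, hφe⟩ := exists_smooth_log hU hsc (f := fun q => g q + c / b)
    (h.smooth_g.add contDiffOn_const) (fun q hq h0 => by
      apply hP0 q hq
      rw [hP q hq]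
      have : b * g q + c = b * (g q + c / b) := by field_simp
      rw [this, h0]; simp)
  refine isPieceOf_of_deriv hU hUc h hP0 hY hφ
    (fun q hq => by simp [WData.regularSet, helicoidData]) (r := δ⁻¹) (by positivity) (u := 1)
    (by simp) (-(c / b)) (fun q hq => by simp [helicoidData, hφe q hq]) fun q hq => ?_
  convert! hasDerivAt_helicoid _ using 1
  have h1 : b * g q + c = b * exp (φ q) := by rw [hφe q hq]; field_simp
  rw [hP q hq, h1, mul_pow, hb]
  simp only [helicoidData, exp_neg]
  push_cast
  field_simp
  simp

theorem SurfaceData.exists_piece_enneper {U : Set ℂ} (hU : IsOpen U) (hUc : IsPreconnected U)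
    {X : ℂ → I3} {g P : ℂ → ℂ} (h : SurfaceData U X g P) {a s : ℂ} (ha : a ≠ 0)
    (hP : ∀ q ∈ U, P q = (a * (g q - s) ^ 2) ^ 2) (hP0 : ∀ q ∈ U, P q ≠ 0) :
    IsPieceOf U X enneperData := by
  obtain ⟨Y, hY⟩ := exists_isSurface_enneper
  have hn : ‖a‖ ≠ 0 := by simpa using ha
  have hn' : (‖a‖ : ℂ) ≠ 0 := by exact_mod_cast hn
  -- With `1/φ = u (g - s)`, the condition `h' = r u² P η` reduces to `u² = -i r a²`.
  obtain ⟨u, hu2, hu⟩ := exists_sq_eq_of_norm_eq_one (v := -I * a ^ 2 / ‖a‖ ^ 2) (by simp [ha])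
  have hu0 : u ≠ 0 := by rintro rfl; simp at hu
  have hgs : ∀ q ∈ U, g q - s ≠ 0 := fun q hq h0 => hP0 q hq (by rw [hP q hq, h0]; simp)
  have hφ0 : ∀ q ∈ U, (u * (g q - s))⁻¹ ≠ 0 := fun q hq =>
    inv_ne_zero (mul_ne_zero hu0 (hgs q hq))
  refine isPieceOf_of_deriv hU hUc h hP0 hY (φ := fun q => (u * (g q - s))⁻¹)
    ((contDiffOn_const.mul (h.smooth_g.sub contDiffOn_const)).inv fun q hq =>
      mul_ne_zero hu0 (hgs q hq))
    (fun q hq => mul_ne_zero I_ne_zero (pow_ne_zero 2 (hφ0 q hq))) (r := (‖a‖ ^ 2)⁻¹)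
    (by positivity) hu (u * s) (fun q hq => by simp [enneperData]; ring) fun q hq => ?_
  convert! hasDerivAt_enneper (hφ0 q hq) using 1
  have h0 := hgs q hq
  rw [hP q hq]
  simp only [enneperData]
  push_cast
  have hu4 : a ^ 2 = I * u ^ 2 * ‖a‖ ^ 2 := by
    rw [hu2]; field_simp; simp
  rw [mul_pow a, hu4]
  field_simp
  simp

/-- The roots of the quadratic polynomial are `s ± ρ`. The rotation `u` makes `ρ` the positive
number `c = α/β`; then `G = u (g - s)` must equal `c coth (α φ / 2)`, and `coth² - 1 = 1/sinh²`
turns `P` into a multiple of `1/sinh⁴`. -/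
theorem SurfaceData.exists_piece_thomsen {U : Set ℂ} (hU : IsOpen U) (hsc : IsSimplyConnected U)
    {X : ℂ → I3} {g P : ℂ → ℂ} (h : SurfaceData U X g P) {a s ρ : ℂ} {δ : ℝ} (ha : a ≠ 0)
    (hδ : 0 < δ) (hρ : 4 * (a * ρ) ^ 2 = I * δ)
    (hP : ∀ q ∈ U, P q = (a * ((g q - s) ^ 2 - ρ ^ 2)) ^ 2) (hP0 : ∀ q ∈ U, P q ≠ 0) :
    ∃ α β : ℝ, 0 < α ∧ 0 < β ∧ IsPieceOf U X (thomsenData α β) := by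
  have hUc := hsc.isPathConnected.isConnected.isPreconnected
  have hδ' : (δ : ℂ) ≠ 0 := by exact_mod_cast hδ.ne'
  have hρ0 : ρ ≠ 0 := by rintro rfl; simp [hδ'] at hρ
  have hc : 0 < ‖ρ‖ := by simpa using hρ0
  have hβ : 0 < 2 * ‖a‖ := by simpa using ha
  have hα : 0 < 2 * ‖a‖ * ‖ρ‖ := mul_pos hβ hc
  set c := ‖ρ‖ with hcdef
  set β := 2 * ‖a‖ with hβdef
  set α := β * c with hαdef
  have hcC : (c : ℂ) ≠ 0 := by exact_mod_cast hc.ne'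
  have hβC : (β : ℂ) ≠ 0 := by exact_mod_cast hβ.ne'
  have hαC : (α : ℂ) ≠ 0 := by exact_mod_cast hα.ne'
  have hαβ : (α / β : ℂ) = c := by rw [hαdef]; push_cast; field_simp
  have hδα : α ^ 2 = δ := by
    have := congrArg norm hρ
    simp [abs_of_pos hδ] at this
    rw [← this, hαdef, hβdef, hcdef]; ring
  obtain ⟨Y, hY⟩ := exists_isSurface_thomsen hα hβ
  set u : ℂ := c / ρ with hu
  have hu1 : ‖u‖ = 1 := by simp [hu, hcdef, hρ0]
  have hu0 : u ≠ 0 := by rintro h0; simp [h0] at hu1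
  have hρu : ρ = c / u := by rw [hu]; field_simp
  set G : ℂ → ℂ := fun q => u * (g q - s) with hG
  have hGP : ∀ q, (a * ((g q - s) ^ 2 - ρ ^ 2)) ^ 2 = a ^ 2 / u ^ 4 * (G q ^ 2 - c ^ 2) ^ 2 := by
    intro q
    rw [hρu, hG]
    field_simp
  have hGc : ∀ q ∈ U, G q + c ≠ 0 ∧ G q - c ≠ 0 := by
    intro q hq
    have h1 := hP0 q hq
    rw [hP q hq, hGP] at h1
    constructor
    · intro h0; apply h1
      rw [show G q ^ 2 - c ^ 2 = (G q + c) * (G q - c) by ring, h0]; simp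
    · intro h0; apply h1
      rw [show G q ^ 2 - c ^ 2 = (G q + c) * (G q - c) by ring, h0]; simp
  have hGs : ContDiffOn ℝ ∞ G U := contDiffOn_const.mul (h.smooth_g.sub contDiffOn_const)
  -- Solving `G = c coth (L/2)` for `e^L` gives this quotient, which is finite and nonzero because
  -- `g` omits both roots. The parameter is `φ = L/α`.
  obtain ⟨L, hL, hLe⟩ := exists_smooth_log hU hsc (f := fun q => (G q + c) / (G q - c))
    (by
      simp only [div_eq_mul_inv]
      exact (hGs.add contDiffOn_const).mul
        ((hGs.sub contDiffOn_const).inv fun q hq => (hGc q hq).2))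
    (fun q hq => div_ne_zero (hGc q hq).1 (hGc q hq).2)
  have hhalf : ∀ q, α * (L q / α) / 2 = L q / 2 := fun q => by field_simp
  have hexp : ∀ q ∈ U, exp (L q / 2) ^ 2 = (G q + c) / (G q - c) := fun q hq => by
    rw [← hLe q hq, ← exp_nat_mul]; congr 1; push_cast; ring
  have hch : ∀ q ∈ U, c * cosh (L q / 2) = G q * sinh (L q / 2) := by
    intro q hq
    have h1 := hexp q hq
    have h2 := (hGc q hq).2
    have h3 := exp_ne_zero (L q / 2)
    rw [cosh, sinh, exp_neg]
    field_simp at h1 ⊢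
    linear_combination -h1
  have hsinh : ∀ q ∈ U, sinh (L q / 2) ≠ 0 := by
    intro q hq h0
    have h1 := hch q hq
    have h2 := cosh_sq (L q / 2)
    rw [h0, mul_zero] at h1
    rw [h0, (mul_eq_zero.1 h1).resolve_left hcC] at h2
    simp at h2
  refine ⟨α, β, hα, hβ, isPieceOf_of_deriv hU hUc h hP0 hY (φ := fun q => L q / α)
    (hL.div_const _) (fun q hq => ?_) one_pos hu1 (u * s) (fun q hq => ?_) fun q hq => ?_⟩
  · refine mul_ne_zero (mul_ne_zero I_ne_zero ?_) (pow_ne_zero 2 ?_)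
    · exact div_ne_zero (mul_ne_zero two_ne_zero hβC) (pow_ne_zero 2 hαC)
    · rw [hhalf]; exact hsinh q hq
  · simp only [thomsenData]
    have := hsinh q hq
    rw [hhalf, hαβ, ← mul_div_assoc, hch q hq, mul_div_cancel_right₀ _ this, hG]
    ring
  · convert! hasDerivAt_thomsen α β (z := L q / α) (by rw [hhalf]; exact hsinh q hq) using 1
    have h0 := hsinh q hq
    have h1 : G q ^ 2 - c ^ 2 = c ^ 2 / sinh (L q / 2) ^ 2 := by
      field_simp
      have := cosh_sq (L q / 2)
      linear_combination (c : ℂ) ^ 2 * this - (c * cosh (L q / 2) + G q * sinh (L q / 2)) * hch q hq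
    simp only [thomsenData]
    rw [hP q hq, hGP, h1, hhalf, hαβ]
    have h2 : 4 * a ^ 2 * c ^ 2 = I * α ^ 2 * u ^ 2 := by
      have : (α : ℂ) ^ 2 = δ := by exact_mod_cast hδα
      rw [this, ← hρ, hρu]; field_simp
    have hα2 : (α : ℂ) = β * c := by rw [hαdef]; push_cast; rfl
    have h3 : a ^ 2 = I * β ^ 2 * u ^ 2 / 4 := by
      rw [hα2] at h2
      have : (c : ℂ) ^ 2 ≠ 0 := pow_ne_zero 2 hcC
      apply mul_right_cancel₀ this
      linear_combination h2 / 4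
    rw [h3, hα2]
    push_cast
    field_simp
    simp
    ring

/-- The sign condition `him` depends on `a` because the models have discriminants of opposite signs:
`-iδ` for the helicoid and `iδ` for the Thomsen-type surfaces, with `δ > 0`. -/
theorem SurfaceData.exists_kind {U : Set ℂ} (hU : IsOpen U) (hsc : IsSimplyConnected U)
    {X : ℂ → I3} {g P : ℂ → ℂ} (h : SurfaceData U X g P) {a b c : ℂ}
    (hre : (b ^ 2 - 4 * a * c).re = 0)
    (him : if a = 0 then (b ^ 2 - 4 * a * c).im ≤ 0 else 0 ≤ (b ^ 2 - 4 * a * c).im)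
    (hP : ∀ q ∈ U, P q = (a * g q ^ 2 + b * g q + c) ^ 2 ∧ P q ≠ 0) :
    ∃ k : Kind, ∃ D ∈ k.data, IsPieceOf U X D := by
  have hUc := hsc.isPathConnected.isConnected.isPreconnected
  have hP0 := fun q hq => (hP q hq).2
  obtain ⟨q₀, hq₀⟩ := hsc.nonempty
  by_cases ha : a = 0
  · subst ha
    simp only [if_true, mul_zero, zero_mul, sub_zero, zero_add] at hre him hP
    by_cases hb : b = 0
    · subst hb
      simp only [zero_mul, zero_add] at hP
      have hc : c ≠ 0 := by rintro rfl; exact hP0 q₀ hq₀ (by rw [(hP q₀ hq₀).1]; simp)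
      exact ⟨.trivialEnneper, _, rfl,
        h.exists_piece_trivialEnneper hU hUc hc fun q hq => (hP q hq).1⟩
    · refine ⟨.helicoid, _, rfl, h.exists_piece_helicoid hU hsc (δ := -(b ^ 2).im) ?_ ?_
        (fun q hq => (hP q hq).1) hP0⟩
      · refine neg_pos.2 (lt_of_le_of_ne him fun h0 => pow_ne_zero 2 hb (Complex.ext hre h0))
      · apply Complex.ext
        · simpa using hre
        · simp
  · simp only [if_neg ha] at him
    by_cases hd : b ^ 2 - 4 * a * c = 0
    · refine ⟨.enneper, _, rfl, h.exists_piece_enneper hU hUc (s := -b / (2 * a)) ha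
        (fun q hq => ?_) hP0⟩
      rw [(hP q hq).1]
      congr 1
      field_simp
      linear_combination -hd
    · obtain ⟨s, hs⟩ := IsAlgClosed.exists_pow_nat_eq (b ^ 2 - 4 * a * c) two_pos
      obtain ⟨α, β, hα, hβ, hp⟩ := h.exists_piece_thomsen hU hsc (s := -b / (2 * a))
        (ρ := s / (2 * a)) (δ := (b ^ 2 - 4 * a * c).im) ha
        (lt_of_le_of_ne him fun h0 => hd (Complex.ext hre h0.symm))
        (by
          have : 4 * (a * (s / (2 * a))) ^ 2 = s ^ 2 := by field_simp; ring
          rw [this, hs]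
          apply Complex.ext
          · simpa using hre
          · simp)
        (fun q hq => by
          rw [(hP q hq).1, div_pow s, hs]
          congr 1
          field_simp
          ring) hP0
      exact ⟨.thomsen, _, ⟨α, β, hα, hβ, rfl⟩, hp⟩

theorem exists_kind_of_isAffineMinimal {U : Set ℂ} (hU : IsOpen U) (hsc : IsSimplyConnected U)
    {X : ℂ → I3} {g P : ℂ → ℂ} (h : SurfaceData U X g P) (hA : IsAffineMinimal U X) :
    ∃ k : Kind, ∃ D ∈ k.data, IsPieceOf U X D := by
  have hUc := hsc.isPathConnected.isConnected.isPreconnected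
  obtain h0 | ⟨a, b, c, hre, hP⟩ := hA.eq_zero_or_exists_quadratic hU hUc h
  · exact ⟨.plane, _, rfl, h.exists_piece_plane hU hUc h0⟩
  by_cases him : if a = 0 then (b ^ 2 - 4 * a * c).im ≤ 0 else 0 ≤ (b ^ 2 - 4 * a * c).im
  · exact h.exists_kind hU hsc hre him hP
  -- With the wrong sign of the discriminant the mirror image is classified instead; the reflection
  -- is itself an isometry.
  · have hconj : conj b ^ 2 - 4 * conj a * conj c = conj (b ^ 2 - 4 * a * c) := by
      rw [map_sub, map_mul, map_mul, map_pow, map_ofNat]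
    obtain ⟨k, D, hD, hp⟩ := (h.refl hU).exists_kind hU hsc (a := conj a) (b := conj b)
      (c := conj c) (by rw [hconj, conj_re, hre]) (by
        rw [hconj, conj_im]
        by_cases ha : a = 0
        · simp only [ha, if_true, map_zero] at him ⊢; linarith
        · have ha' : conj a ≠ 0 := by simpa using ha
          simp only [if_neg ha, if_neg ha'] at him ⊢; linarith)
      (fun q hq => by
        refine ⟨?_, by simpa using (hP q hq).2⟩
        rw [(hP q hq).1]; simp)
    exact ⟨k, D, hD, hp.of_refl⟩

/-! ### Uniqueness -/

/-- The shape of a similarity of isotropic space in the coordinates `(l, ζ)`. -/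
theorem IsSimilarity.exists_form {T : I3 → I3} (hT : IsSimilarity T) :
    ∃ (r : ℝ) (u m : ℂ) (t₀ : ℝ) (t₁ : ℂ), 0 < r ∧ ‖u‖ = 1 ∧
      (∀ Q, T Q 0 = r * (Q 0 + (m * horL Q).re) + t₀) ∧
      ((∀ Q, horL (T Q) = r * (u * horL Q) + t₁) ∨
        ∀ Q, horL (T Q) = r * (u * conj (horL Q)) + t₁) := by
  obtain ⟨r, S, hr, ⟨A, t, hA, hAp, hS⟩, hT⟩ := hT
  set e₁ : Minkowski := ![0, 1, 0, 0] with he₁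
  set e₂ : Minkowski := ![0, 0, 1, 0] with he₂
  have hdec : ∀ Q, toMink Q = Q 0 • pVec + Q 1 • e₁ + Q 2 • e₂ := by
    intro Q; ext i; fin_cases i <;> simp [toMink, pVec, he₁, he₂]
  have hAd : ∀ Q, toMink (S Q) = Q 0 • pVec + Q 1 • A e₁ + Q 2 • A e₂ + toMink t := by
    intro Q; rw [hS, hdec Q]; simp [hAp]
  have hS0 : ∀ Q, S Q 0 = Q 0 + Q 1 * A e₁ 0 + Q 2 * A e₂ 0 + t 0 := fun Q => by
    have := congrFun (hAd Q) 0
    simp only [Pi.add_apply, Pi.smul_apply, smul_eq_mul] at this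
    simpa [toMink, pVec] using this
  have hS1 : ∀ Q, S Q 1 = Q 1 * A e₁ 1 + Q 2 * A e₂ 1 + t 1 := fun Q => by
    have := congrFun (hAd Q) 1
    simp only [Pi.add_apply, Pi.smul_apply, smul_eq_mul] at this
    simpa [toMink, pVec] using this
  have hS2 : ∀ Q, S Q 2 = Q 1 * A e₁ 2 + Q 2 * A e₂ 2 + t 2 := fun Q => by
    have := congrFun (hAd Q) 2
    simp only [Pi.add_apply, Pi.smul_apply, smul_eq_mul] at this
    simpa [toMink, pVec] using this
  have hS3 : ∀ Q, S Q 0 = Q 0 + Q 1 * A e₁ 3 + Q 2 * A e₂ 3 + t 0 := fun Q => by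
    have := congrFun (hAd Q) 3
    simp only [Pi.add_apply, Pi.smul_apply, smul_eq_mul] at this
    simpa [toMink, pVec] using this
  -- The image of isotropic space lies in isotropic space. Hence the outer components cancel in the
  -- form, and what is left of the isometry condition is orthogonality of the horizontal `2 × 2`
  -- block.
  have q1 : A e₁ 3 = A e₁ 0 := by
    have h1 := hS0 ![0, 1, 0]
    rw [hS3] at h1
    simpa using h1
  have q2 : A e₂ 3 = A e₂ 0 := by
    have h1 := hS0 ![0, 0, 1]
    rw [hS3] at h1
    simpa using h1
  have n11 := hA e₁ e₁
  have n12 := hA e₁ e₂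
  have n22 := hA e₂ e₂
  simp only [mink, q1, q2] at n11 n12 n22
  simp [he₁, he₂] at n11 n12 n22
  rw [← he₁] at n11 n12
  rw [← he₂] at n12 n22
  set a := A e₁ 1
  set b := A e₁ 2
  set c := A e₂ 1
  set d := A e₂ 2
  have hab : a * a + b * b = 1 := by linarith
  have hcd : c * c + d * d = 1 := by linarith
  have hac : a * c + b * d = 0 := by linarith
  have hdet : (a * d - b * c) ^ 2 = 1 := by
    linear_combination hab * (c * c + d * d) + hcd - (a * c + b * d) * hac
  have hu : ‖(⟨a, b⟩ : ℂ)‖ = 1 := by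
    rw [← pow_eq_one_iff_of_nonneg (norm_nonneg _) two_ne_zero, ← normSq_eq_norm_sq, normSq_mk, hab]
  refine ⟨r, ⟨a, b⟩, ⟨A e₁ 0, -A e₂ 0⟩, t 0, horL t, hr, hu, fun Q => ?_, ?_⟩
  · rw [hT, hS0]
    simp
    ring
  · have k1 : ∀ Q, T Q 1 = r * (Q 1 * a + Q 2 * c) + t 1 := fun Q => by
      rw [hT, hS1]; simp; ring
    have k2 : ∀ Q, T Q 2 = r * (Q 1 * b + Q 2 * d) + t 2 := fun Q => by
      rw [hT, hS2]; simp; ring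
    -- The block is a rotation, `ζ ↦ u ζ`, or a reflection, `ζ ↦ u conj ζ`.
    rcases sq_eq_one_iff.1 hdet with h | h
    · have hc : c = -b := by linear_combination -c * hab + a * hac - b * h
      have hd : d = a := by linear_combination -d * hab + b * hac + a * h
      refine .inl fun Q => Complex.ext ?_ ?_
      · simp [k1, hc]; left; ring
      · simp [k2, hd]; left; ring
    · have hc : c = b := by linear_combination -c * hab + a * hac - b * h
      have hd : d = -a := by linear_combination -d * hab + b * hac + a * h
      refine .inr fun Q => Complex.ext ?_ ?_
      · simp [k1, hc]; left; ring
      · simp [k2, hd]; left; ring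

/-- `P` is, up to a motion in the target, the polynomial `S` in `g`. -/
def HasProfile (U : Set ℂ) (g P : ℂ → ℂ) (S : Polynomial ℝ) : Prop :=
  ∃ A u v : ℂ, A ≠ 0 ∧ ‖u‖ = 1 ∧ ∀ q ∈ U, P q = A * S.aeval (u * g q + v)

/-- Comparing the differentials of `X` and of the model gives `u g = h ∘ φ + m`, or the same with `u
g` conjugated. Differentiating once more turns the equation `h' = K S(h) η` into a formula for `P`
that no longer involves the parameter. -/
theorem SurfaceData.hasProfile {U : Set ℂ} (hU : IsOpen U) {X : ℂ → I3} {g P : ℂ → ℂ}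
    (h : SurfaceData U X g P) {D : WData} (hp : IsPieceOf U X D) {S : Polynomial ℝ} {K : ℂ}
    (hK : K ≠ 0)
    (hD : ∀ z ∈ D.regularSet, HasDerivAt D.h (D.η z * (K * S.aeval (D.h z))) z) :
    HasProfile U g P S ∧ ((∀ z ∈ D.regularSet, S.aeval (D.h z) ≠ 0) → ∀ q ∈ U, P q ≠ 0) := by
  obtain ⟨Y, T, φ, hY, hT, hφ, hq⟩ := hp
  obtain ⟨r, u, m, t₀, t₁, hr, hu, hT0, hT1⟩ := hT.exists_form
  have hr' : (r : ℂ) ≠ 0 := by exact_mod_cast hr.ne'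
  have hu0 : u ≠ 0 := by rintro rfl; simp at hu
  have hφd := fun q (hq' : q ∈ U) => (differentiableAt_of_contDiffOn hU hφ hq').hasFDerivAt
  have hYd := fun q (hq' : q ∈ U) => hY.hasFDerivAt hU (fun q hq' => (hq q hq').1) hq' (hφd q hq')
  have hXd : ∀ q ∈ U, HasFDerivAt X (fderiv ℝ X q) q := fun q hq =>
    (differentiableAt_of_contDiffOn hU h.smooth hq).hasFDerivAt
  have hη : ∀ q ∈ U, D.η (φ q) ≠ 0 := fun q hq' => (hq q hq').1
  have hver : ∀ q ∈ U, ∀ w, fderiv ℝ X q w 0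
      = r * ((D.h (φ q) + m) * (D.η (φ q) * fderiv ℝ φ q w)).re := by
    intro q hq' w
    obtain ⟨⟨L₀, hL₀, hL₀w⟩, L₁, hL₁, hL₁w⟩ := hYd q hq'
    have h1 : HasFDerivAt (fun q => X q 0) _ q := (((hL₀.add (reCLM.hasFDerivAt.comp q
      (hL₁.const_mul m))).const_mul r).add_const t₀).congr_of_eventuallyEq (by
        filter_upwards [hU.mem_nhds hq'] with y hy
        rw [(hq y hy).2.2, hT0]; simp)
    have h2 : HasFDerivAt (fun q => X q 0) _ q := verL.hasFDerivAt.comp q (hXd q hq')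
    have := congrArg (fun L => L w) (h2.unique h1)
    simp only [ContinuousLinearMap.comp_apply, verL_apply, smul_apply, add_apply, hL₀w, hL₁w,
      reCLM_apply, smul_eq_mul] at this
    rw [this, ← add_re, add_mul]
  have hsurj : ∀ q ∈ U, ∀ y, ∃ w, D.η (φ q) * fderiv ℝ φ q w = y := by
    intro q hq' y
    obtain ⟨w, hw⟩ := (hq q hq').2.1.2 ((D.η (φ q))⁻¹ * y)
    exact ⟨w, by rw [hw, mul_inv_cancel_left₀ (hη q hq')]⟩
  have hhd : ∀ q ∈ U, HasFDerivAt (fun q => D.h (φ q) + m) _ q := fun q hq' =>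
    ((((hD _ (hq q hq').1).hasFDerivAt.restrictScalars ℝ).comp q (hφd q hq')).add_const m)
  have hgd : ∀ q ∈ U, HasFDerivAt (fun q => u * g q) (u • fderiv ℝ g q) q := fun q hq' =>
    (differentiableAt_of_contDiffOn hU h.smooth_g hq').hasFDerivAt.const_mul u
  rcases hT1 with hT1 | hT1
  · have hhor : ∀ q ∈ U, ∀ w, horL (fderiv ℝ X q w)
        = r * (u * (D.η (φ q) * fderiv ℝ φ q w)) := by
      intro q hq' w
      obtain ⟨-, L₁, hL₁, hL₁w⟩ := hYd q hq'
      have h1 : HasFDerivAt (fun q => horL (X q)) _ q :=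
        (((hL₁.const_mul u).const_mul (r : ℂ)).add_const t₁).congr_of_eventuallyEq (by
          filter_upwards [hU.mem_nhds hq'] with y hy
          rw [(hq y hy).2.2, hT1])
      have h2 : HasFDerivAt (fun q => horL (X q)) _ q := horL.hasFDerivAt.comp q (hXd q hq')
      have := congrArg (fun L => L w) (h2.unique h1)
      simpa [hL₁w] using this
    have hg : ∀ q ∈ U, u * g q = D.h (φ q) + m := by
      intro q hq'
      rw [← sub_eq_zero]
      refine eq_zero_of_forall_re_mul_eq_zero fun y => ?_
      obtain ⟨w, rfl⟩ := hsurj q hq' y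
      have h1 := h.dl q hq' w
      rw [hver q hq', hhor q hq', show g q * (r * (u * (D.η (φ q) * fderiv ℝ φ q w)))
        = r * (u * g q * (D.η (φ q) * fderiv ℝ φ q w)) by ring, re_ofReal_mul] at h1
      rw [sub_mul, sub_re, mul_left_cancel₀ hr.ne' h1, sub_self]
    have hPS : ∀ q ∈ U, P q * (r * u ^ 2) = K * S.aeval (D.h (φ q)) := by
      intro q hq'
      obtain ⟨w, hw⟩ := hsurj q hq' 1
      have h1 := (hgd q hq').unique ((hhd q hq').congr_of_eventuallyEq (by
        filter_upwards [hU.mem_nhds hq'] with y hy using hg y hy))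
      have h2 := congrArg (fun L => L w) h1
      simp [h.dg q hq', hhor q hq'] at h2
      linear_combination h2 + (K * S.aeval (D.h (φ q)) - P q * (r * u ^ 2)) * hw
    refine ⟨⟨K * (r * u ^ 2)⁻¹, u, -m, mul_ne_zero hK (inv_ne_zero (by positivity)), hu,
      fun q hq' => ?_⟩, fun hS q hq' h0 => ?_⟩
    · rw [hg q hq', add_neg_cancel_right, mul_right_comm, ← hPS q hq']
      field_simp
    · have := hPS q hq'
      rw [h0, zero_mul] at this
      exact mul_ne_zero hK (hS _ (hq q hq').1) this.symm
  · have hhor : ∀ q ∈ U, ∀ w, horL (fderiv ℝ X q w)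
        = r * (u * conj (D.η (φ q) * fderiv ℝ φ q w)) := by
      intro q hq' w
      obtain ⟨-, L₁, hL₁, hL₁w⟩ := hYd q hq'
      have h1 : HasFDerivAt (fun q => horL (X q)) _ q :=
        (((((conjCLE : ℂ →L[ℝ] ℂ).hasFDerivAt.comp q hL₁).const_mul u).const_mul
          (r : ℂ)).add_const t₁).congr_of_eventuallyEq (by
          filter_upwards [hU.mem_nhds hq'] with y hy
          rw [(hq y hy).2.2, hT1]; simp)
      have h2 : HasFDerivAt (fun q => horL (X q)) _ q := horL.hasFDerivAt.comp q (hXd q hq')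
      have := congrArg (fun L => L w) (h2.unique h1)
      simpa [hL₁w] using this
    have hg : ∀ q ∈ U, conj (u * g q) = D.h (φ q) + m := by
      intro q hq'
      rw [← sub_eq_zero]
      refine eq_zero_of_forall_re_mul_eq_zero fun y => ?_
      obtain ⟨w, rfl⟩ := hsurj q hq' y
      have h1 := h.dl q hq' w
      rw [hver q hq', hhor q hq', show g q * (r * (u * conj (D.η (φ q) * fderiv ℝ φ q w)))
        = r * conj (conj (u * g q) * (D.η (φ q) * fderiv ℝ φ q w)) by
          rw [map_mul conj (conj (u * g q)), conj_conj]; ring, re_ofReal_mul, conj_re] at h1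
      rw [sub_mul, sub_re, mul_left_cancel₀ hr.ne' h1, sub_self]
    have hPS : ∀ q ∈ U, conj (P q * (r * u ^ 2)) = K * S.aeval (D.h (φ q)) := by
      intro q hq'
      obtain ⟨w, hw⟩ := hsurj q hq' 1
      have h1 := ((conjCLE : ℂ →L[ℝ] ℂ).hasFDerivAt.comp q (hgd q hq')).unique
        ((hhd q hq').congr_of_eventuallyEq (by
          filter_upwards [hU.mem_nhds hq'] with y hy using hg y hy))
      have h2 := congrArg (fun L => L w) h1
      simp [h.dg q hq', hhor q hq'] at h2
      simp only [map_mul, map_pow, conj_ofReal]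
      linear_combination h2
        + (K * S.aeval (D.h (φ q)) - conj (P q) * (r * conj u ^ 2)) * hw
    refine ⟨⟨conj K * (r * u ^ 2)⁻¹, u, -conj m, mul_ne_zero (by simpa using hK)
      (inv_ne_zero (by positivity)), hu, fun q hq' => ?_⟩, fun hS q hq' h0 => ?_⟩
    · have h1 : u * g q + -conj m = conj (D.h (φ q)) := by
        have := congrArg conj (hg q hq')
        rw [conj_conj, map_add] at this
        rw [this, add_neg_cancel_right]
      -- Real coefficients of `S` make the profile the same for both orientations.
      have h2 : S.aeval (conj (D.h (φ q))) = conj (S.aeval (D.h (φ q))) :=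
        Polynomial.aeval_conj S _
      have h3 := congrArg conj (hPS q hq')
      rw [conj_conj, map_mul conj K] at h3
      rw [h1, h2, mul_right_comm, ← h3]
      field_simp
    · have := hPS q hq'
      rw [h0, zero_mul, map_zero] at this
      exact mul_ne_zero hK (hS _ (hq q hq').1) this.symm

/-- The polynomials `S` for which `P` is a multiple of `S` in `g`, up to motions, on the surfaces
of each kind. -/
def Kind.profiles : Kind → Set (Polynomial ℝ)
  | .plane => {0}
  | .trivialEnneper => {1}
  | .helicoid => {Polynomial.X ^ 2}
  | .enneper => {Polynomial.X ^ 4}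
  | .thomsen => {S | ∃ c : ℝ, 0 < c ∧ S = (Polynomial.X ^ 2 - Polynomial.C (c ^ 2)) ^ 2}

section Profiles

variable {U : Set ℂ} {X : ℂ → I3} {g P : ℂ → ℂ}

/-- Both `h'` and `η` are powers of `sinh` up to constants, and `coth² - 1 = 1/sinh²` expresses
`h'/η` by `h`: the roots are `±α/β`. -/
theorem SurfaceData.hasProfile_thomsen (hU : IsOpen U) (h : SurfaceData U X g P) {α β : ℝ}
    (hα : 0 < α) (hβ : 0 < β) (hp : IsPieceOf U X (thomsenData α β)) :
    HasProfile U g P ((Polynomial.X ^ 2 - Polynomial.C ((α / β) ^ 2)) ^ 2) ∧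
      ∀ q ∈ U, P q ≠ 0 := by
  have hα' : (α : ℂ) ≠ 0 := by exact_mod_cast hα.ne'
  have hβ' : (β : ℂ) ≠ 0 := by exact_mod_cast hβ.ne'
  have hs : ∀ z ∈ (thomsenData α β).regularSet, sinh (α * z / 2) ≠ 0 := by
    intro z hz h0; simp [WData.regularSet, thomsenData, h0] at hz
  have key : ∀ z ∈ (thomsenData α β).regularSet,
      Polynomial.aeval ((thomsenData α β).h z)
        ((Polynomial.X ^ 2 - Polynomial.C ((α / β) ^ 2)) ^ 2 : Polynomial ℝ)
      = ((α / β) ^ 2 / sinh (α * z / 2) ^ 2) ^ 2 := by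
    intro z hz
    have h0 := hs z hz
    have := cosh_sq (α * z / 2)
    simp only [thomsenData, map_pow, map_sub, Polynomial.aeval_X, Polynomial.aeval_C,
      coe_algebraMap]
    push_cast
    congr 1
    field_simp
    linear_combination this
  refine (h.hasProfile hU hp (K := I * β ^ 2 / 4) (by simp [hβ']) fun z hz => ?_).imp_right
    fun h1 => h1 fun z hz => ?_
  · convert! hasDerivAt_thomsen α β (hs z hz) using 1
    have h0 := hs z hz
    rw [key z hz]
    simp only [thomsenData]
    field_simp
    simp
    ring
  · rw [key z hz]
    have h0 := hs z hz
    positivity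

theorem SurfaceData.exists_hasProfile (hU : IsOpen U) (h : SurfaceData U X g P) {k : Kind}
    {D : WData} (hD : D ∈ k.data) (hp : IsPieceOf U X D) :
    ∃ S ∈ k.profiles, HasProfile U g P S ∧ (k ≠ .plane → ∀ q ∈ U, P q ≠ 0) := by
  cases k with
  | plane =>
    obtain rfl : D = planeData := hD
    refine ⟨0, rfl, (h.hasProfile hU hp one_ne_zero fun z _ => ?_).1, fun h => absurd rfl h⟩
    simpa [planeData] using hasDerivAt_const z (0 : ℂ)
  | trivialEnneper =>
    obtain rfl : D = trivialEnneperData := hD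
    refine ⟨1, rfl, (h.hasProfile hU hp (K := -I) (by simp) fun z _ => ?_).imp_right
      fun h1 _ => h1 fun z _ => by simp⟩
    simpa [trivialEnneperData] using hasDerivAt_trivialEnneper z
  | helicoid =>
    obtain rfl : D = helicoidData := hD
    refine ⟨_, rfl, (h.hasProfile hU hp (K := -I) (by simp) fun z _ => ?_).imp_right
      fun h1 _ => h1 fun z _ => by simp [helicoidData]⟩
    convert! hasDerivAt_helicoid z using 1
    simp [helicoidData, exp_neg]
    field_simp
    simp
  | enneper =>
    obtain rfl : D = enneperData := hD
    have hz0 : ∀ z ∈ enneperData.regularSet, z ≠ 0 := by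
      rintro z hz rfl; simp [WData.regularSet, enneperData] at hz
    refine ⟨_, rfl, (h.hasProfile hU hp (K := I) (by simp) fun z hz => ?_).imp_right
      fun h1 _ => h1 fun z hz => by simp [enneperData, hz0 z hz]⟩
    have := hz0 z hz
    convert! hasDerivAt_enneper this using 1
    simp [enneperData]
    field_simp
    simp
  | thomsen =>
    obtain ⟨α, β, hα, hβ, rfl⟩ := hD
    obtain ⟨h1, h2⟩ := h.hasProfile_thomsen hU hα hβ hp
    exact ⟨_, ⟨α / β, by positivity, rfl⟩, h1, fun _ => h2⟩

/-- Since `P ≠ 0` somewhere, `g` is not constant, and a connected set with two points is infinite.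
Polynomial identities in `g` therefore hold identically. -/
theorem SurfaceData.infinite_image (hU : IsOpen U) (hUc : IsPreconnected U)
    (h : SurfaceData U X g P) {q₀ : ℂ} (hq₀ : q₀ ∈ U) (hP : P q₀ ≠ 0) : (g '' U).Infinite := by
  refine (hUc.image g h.smooth_g.continuousOn).infinite_of_nontrivial ?_
  by_contra hs
  rw [not_nontrivial_iff] at hs
  have h1 : HasFDerivAt g (0 : ℂ →L[ℝ] ℂ) q₀ :=
    (hasFDerivAt_const (g q₀) q₀).congr_of_eventuallyEq (by
      filter_upwards [hU.mem_nhds hq₀] with q hq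
        using hs (mem_image_of_mem g hq) (mem_image_of_mem g hq₀))
  obtain ⟨w, hw⟩ := (h.bij q₀ hq₀).2 1
  have h2 := h.dg q₀ hq₀ w
  rw [h1.fderiv] at h2
  simp only at hw
  rw [hw, mul_one] at h2
  exact hP h2.symm

end Profiles

/-- Two polynomials agree up to affine changes of the variable by isometries of the plane and
up to factors. -/
def SameProfile (S S' : Polynomial ℝ) : Prop :=
  ∃ A u v A' u' v' : ℂ, A ≠ 0 ∧ A' ≠ 0 ∧ ‖u‖ = 1 ∧ ‖u'‖ = 1 ∧
    ∀ x : ℂ, A * S.aeval (u * x + v) = A' * S'.aeval (u' * x + v')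

theorem SameProfile.symm {S S' : Polynomial ℝ} (h : SameProfile S S') : SameProfile S' S := by
  obtain ⟨A, u, v, A', u', v', hA, hA', hu, hu', h⟩ := h
  exact ⟨A', u', v', A, u, v, hA', hA, hu', hu, fun x => (h x).symm⟩

/-- The polynomial `A S(u x + v)`. -/
noncomputable def affineComp (S : Polynomial ℝ) (A u v : ℂ) : Polynomial ℂ :=
  Polynomial.C A * (S.map (algebraMap ℝ ℂ)).comp (Polynomial.C u * Polynomial.X + Polynomial.C v)

theorem eval_affineComp (S : Polynomial ℝ) (A u v x : ℂ) :
    (affineComp S A u v).eval x = A * S.aeval (u * x + v) := by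
  simp [affineComp, Polynomial.eval_comp, Polynomial.aeval_def]

theorem natDegree_affineComp (S : Polynomial ℝ) {A u : ℂ} (hA : A ≠ 0) (hu : ‖u‖ = 1) (v : ℂ) :
    (affineComp S A u v).natDegree = S.natDegree := by
  have hu0 : u ≠ 0 := by rintro rfl; simp at hu
  rw [affineComp, Polynomial.natDegree_C_mul hA, Polynomial.natDegree_comp,
    Polynomial.natDegree_linear hu0, mul_one, Polynomial.natDegree_map]

theorem SameProfile.natDegree_eq {S S' : Polynomial ℝ} (h : SameProfile S S') :
    S.natDegree = S'.natDegree := by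
  obtain ⟨A, u, v, A', u', v', hA, hA', hu, hu', h⟩ := h
  rw [← natDegree_affineComp S hA hu v, ← natDegree_affineComp S' hA' hu' v']
  congr 1
  exact Polynomial.funext fun x => by rw [eval_affineComp, eval_affineComp, h]

theorem HasProfile.sameProfile {U : Set ℂ} {g P : ℂ → ℂ} {S S' : Polynomial ℝ}
    (h : HasProfile U g P S) (h' : HasProfile U g P S') (hg : (g '' U).Infinite) :
    SameProfile S S' := by
  obtain ⟨A, u, v, hA, hu, h⟩ := h
  obtain ⟨A', u', v', hA', hu', h'⟩ := h'
  refine ⟨A, u, v, A', u', v', hA, hA', hu, hu', fun x => ?_⟩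
  rw [← eval_affineComp, ← eval_affineComp]
  congr 1
  refine Polynomial.eq_of_infinite_eval_eq _ _ (hg.mono ?_)
  rintro _ ⟨q, hq, rfl⟩
  simp only [mem_ofPred_eq, eval_affineComp]
  rw [← h q hq, ← h' q hq]

theorem natDegree_thomsen (c : ℝ) :
    ((Polynomial.X ^ 2 - Polynomial.C (c ^ 2)) ^ 2 : Polynomial ℝ).natDegree = 4 := by
  rw [Polynomial.natDegree_pow, Polynomial.natDegree_X_pow_sub_C]

/-- The two roots `±c` of the second polynomial would correspond, under an injective affine map, to
the single root of `X⁴`. -/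
theorem not_sameProfile_enneper_thomsen {c : ℝ} (hc : 0 < c) :
    ¬ SameProfile (Polynomial.X ^ 4) ((Polynomial.X ^ 2 - Polynomial.C (c ^ 2)) ^ 2) := by
  rintro ⟨A, u, v, A', u', v', hA, hA', hu, hu', h⟩
  have hu0 : u ≠ 0 := by rintro rfl; simp at hu
  have hu0' : u' ≠ 0 := by rintro rfl; simp at hu'
  have hc' : (c : ℂ) ≠ 0 := by exact_mod_cast hc.ne'
  simp only [map_pow, map_sub, Polynomial.aeval_X, Polynomial.aeval_C, coe_algebraMap] at h
  have h1 := h ((c - v') / u')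
  have h2 := h ((-c - v') / u')
  rw [mul_div_cancel₀ _ hu0', sub_add_cancel] at h1 h2
  simp [hA] at h1 h2
  have h3 : u * (2 * c / u') = 0 := by linear_combination h1 - h2
  simp [hu0, hu0', hc'] at h3

/-- An affine map with linear coefficient of modulus one carries the roots `±c'` to the roots `±c`
and preserves their distance. -/
theorem eq_of_sameProfile_thomsen {c c' : ℝ} (hc : 0 < c) (hc' : 0 < c')
    (h : SameProfile ((Polynomial.X ^ 2 - Polynomial.C (c ^ 2)) ^ 2)
      ((Polynomial.X ^ 2 - Polynomial.C (c' ^ 2)) ^ 2)) : c = c' := by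
  obtain ⟨A, u, v, A', u', v', hA, hA', hu, hu', h⟩ := h
  have hu0 : u ≠ 0 := by rintro rfl; simp at hu
  have hu0' : u' ≠ 0 := by rintro rfl; simp at hu'
  have hc0 : (c' : ℂ) ≠ 0 := by exact_mod_cast hc'.ne'
  simp only [map_pow, map_sub, Polynomial.aeval_X, Polynomial.aeval_C, coe_algebraMap] at h
  have h1 := h ((c' - v') / u')
  have h2 := h ((-c' - v') / u')
  rw [mul_div_cancel₀ _ hu0', sub_add_cancel] at h1 h2
  simp [hA] at h1 h2
  set y₁ := u * ((c' - v') / u') + v with hy₁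
  set y₂ := u * ((-c' - v') / u') + v with hy₂
  have h3 : y₁ - y₂ = 2 * (c' * (u / u')) := by
    rw [hy₁, hy₂]; field_simp; ring
  -- Both `y₁` and `y₂` have square `c²` and they are distinct, so they are opposite.
  have h4 : y₁ + y₂ = 0 := by
    have h5 : y₁ - y₂ ≠ 0 := by
      rw [h3]; exact mul_ne_zero two_ne_zero (mul_ne_zero hc0 (div_ne_zero hu0 hu0'))
    refine (mul_eq_zero.1 (?_ : (y₁ - y₂) * (y₁ + y₂) = 0)).resolve_left h5
    linear_combination h1 - h2
  have h6 : y₁ = c' * (u / u') := by linear_combination (h3 + h4) / 2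
  have h7 := congrArg norm (show y₁ ^ 2 = (c : ℂ) ^ 2 by linear_combination h1)
  rw [h6] at h7
  simp [hu, hu', abs_of_pos hc, abs_of_pos hc'] at h7
  exact ((pow_left_inj₀ hc'.le hc.le two_ne_zero).1 h7).symm

/-- The degree of the polynomials in `Kind.profiles`. -/
def Kind.degree : Kind → ℕ
  | .plane => 0
  | .trivialEnneper => 0
  | .helicoid => 2
  | .enneper => 4
  | .thomsen => 4

theorem Kind.natDegree_eq {k : Kind} {S : Polynomial ℝ} (hS : S ∈ k.profiles) :
    S.natDegree = k.degree := by
  cases k with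
  | plane => obtain rfl : S = 0 := hS; exact Polynomial.natDegree_zero
  | trivialEnneper => obtain rfl : S = 1 := hS; exact Polynomial.natDegree_one
  | helicoid => obtain rfl : S = Polynomial.X ^ 2 := hS; exact Polynomial.natDegree_X_pow 2
  | enneper => obtain rfl : S = Polynomial.X ^ 4 := hS; exact Polynomial.natDegree_X_pow 4
  | thomsen => obtain ⟨c, -, rfl⟩ := hS; exact natDegree_thomsen c

/-- The degree separates all pairs except Enneper and Thomsen, where the number of distinct roots
decides. The plane has to be excluded because its profile shares degree zero with the trivial
Enneper-type surface. -/
theorem Kind.eq_of_sameProfile {k k' : Kind} (hk : k ≠ .plane) (hk' : k' ≠ .plane)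
    {S S' : Polynomial ℝ} (hS : S ∈ k.profiles) (hS' : S' ∈ k'.profiles) (h : SameProfile S S') :
    k = k' := by
  have hd := h.natDegree_eq
  rw [Kind.natDegree_eq hS, Kind.natDegree_eq hS'] at hd
  have key : ∀ {S S' : Polynomial ℝ}, S ∈ Kind.enneper.profiles → S' ∈ Kind.thomsen.profiles →
      ¬ SameProfile S S' := by
    rintro S _ hS ⟨c, hc, rfl⟩
    obtain rfl : S = Polynomial.X ^ 4 := hS
    exact not_sameProfile_enneper_thomsen hc
  cases k <;> cases k' <;>
    first
    | rfl
    | exact absurd rfl hk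
    | exact absurd rfl hk'
    | exact absurd hd (by decide)
    | exact absurd h (key hS hS')
    | exact absurd h.symm (key hS' hS)

theorem SurfaceData.kind_unique {U : Set ℂ} (hU : IsOpen U) (hUc : IsPreconnected U)
    (hne : U.Nonempty) {X : ℂ → I3} {g P : ℂ → ℂ} (h : SurfaceData U X g P) {k k' : Kind}
    {D D' : WData} (hD : D ∈ k.data) (hp : IsPieceOf U X D) (hD' : D' ∈ k'.data)
    (hp' : IsPieceOf U X D') : k = k' := by
  obtain ⟨q, hq⟩ := hne
  obtain ⟨S, hS, h1, h2⟩ := h.exists_hasProfile hU hD hp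
  obtain ⟨S', hS', h1', h2'⟩ := h.exists_hasProfile hU hD' hp'
  -- Only the plane has a zero of `P`, and there `P` vanishes everywhere, so a single point decides
  -- whether both kinds are the plane.
  by_cases hPq : P q = 0
  · have hk : k = .plane := by by_contra hk; exact h2 hk q hq hPq
    have hk' : k' = .plane := by by_contra hk'; exact h2' hk' q hq hPq
    rw [hk, hk']
  · have hpl : ∀ {k : Kind} {S : Polynomial ℝ}, S ∈ k.profiles → HasProfile U g P S →
        k ≠ .plane := by
      rintro k S hS ⟨A, u, v, -, -, hA⟩ rfl
      obtain rfl : S = 0 := hS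
      exact hPq (by rw [hA q hq]; simp)
    exact Kind.eq_of_sameProfile (hpl hS h1) (hpl hS' h1') hS hS'
      (h1.sameProfile h1' (h.infinite_image hU hUc hq hPq))

end Isotropic

/-! ### The classification theorem -/

theorem theorem6p2 (U : Set ℂ) (hU : IsOpen U) (hsc : IsSimplyConnected U)
    (X : ℂ → Isotropic.I3) (hX : Isotropic.IsSpacelikeImmersion U X)
    (hH : Isotropic.HasZeroMeanCurvature U X) (hA : Isotropic.IsAffineMinimal U X) :
    (∃! k : Isotropic.Kind, ∃ D ∈ k.data, Isotropic.IsPieceOf U X D) ∧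
    (∀ α β α' β' : ℝ, 0 < α → 0 < β → 0 < α' → 0 < β' →
      Isotropic.IsPieceOf U X (Isotropic.thomsenData α β) →
      Isotropic.IsPieceOf U X (Isotropic.thomsenData α' β') → α / β = α' / β') := by
  obtain ⟨g, P, h⟩ := Isotropic.exists_surfaceData hU hX hH
  have hUc := hsc.isPathConnected.isConnected.isPreconnected
  constructor
  · obtain ⟨k, D, hD, hp⟩ := Isotropic.exists_kind_of_isAffineMinimal hU hsc h hA
    refine ⟨k, ⟨D, hD, hp⟩, ?_⟩
    rintro k' ⟨D', hD', hp'⟩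
    exact h.kind_unique hU hUc hsc.nonempty hD' hp' hD hp
  · intro α β α' β' hα hβ hα' hβ' hp hp'
    obtain ⟨q, hq⟩ := hsc.nonempty
    obtain ⟨h1, h0⟩ := h.hasProfile_thomsen hU hα hβ hp
    obtain ⟨h1', -⟩ := h.hasProfile_thomsen hU hα' hβ' hp'
    exact Isotropic.eq_of_sameProfile_thomsen (by positivity) (by positivity)
      (h1.sameProfile h1' (h.infinite_image hU hUc hq (h0 q hq)))
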